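/- Let $\ell\ge 3$. Let $v_1,\dots,v_\ell$ be an orthonormal basis of $\mathbb{R}^\ell$, with simple roots of type $D_\ell$ given by $v_i-v_{i+1}$ ($1\le i<\ell$) and $v_{\ell-1}+v_\ell$, fundamental weights $\overline\Lambda_1,\dots,\overline\Lambda_\ell$, $\overline\rho=\sum_j\overline\Lambda_j$, Weyl group $W^\circ$ (permutations of the coordinates combined with an even number of sign changes), and dual Kac labels $a_j^\vee=2$ for $2\le j\le \ell-2$ and $a_j^\vee=1$ for $j=1,\ell-1,\ell$. Let $$P=\Big\{\overline\rho+\sum_{j=1}^\ell\lambda_j\overline\Lambda_j \;:\; \lambda_j\in\mathbb{Z}_{\ge0},\ \sum_{j=1}^\ell a_j^\vee\lambda_j\le 2\Big\}$$ be the index set of level $2$. The Kac–Peterson matrix of $D^{(1)}_\ell$ at level $2$ is the matrix $$S_{\lambda,\mu}=\mathrm{c}\sum_{w\in W^\circ}\det(w)\exp\Big(-\frac{2\pi \mathrm{i}\,(\lambda\mid w\mu)}{2\ell}\Big)\qquad(\lambda,\mu\in P),$$ where the constant $\mathrm{c}$ is such that $S$ is unitary and that the row and the column of $\overline\rho$ have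 positive real entries. The fusion algebra $D^{(1)}_{\ell,2}$ has a basis indexed by $P$, with unit $\overline\rho$ and the structure constants $N_{\lambda\mu}^{\kappa}=\sum_{\tau\in P} S_{\tau,\lambda}S_{\tau,\mu}\overline{S_{\tau,\kappa}}/S_{\tau,\overline\rho}$, and its $s$-matrix is $s_{\lambda,\mu}=S_{\lambda,\mu}/S_{\lambda,\overline\rho}$. Put $$\nu_0=\overline\rho,\quad \nu_0'=\overline\rho+2\overline\Lambda_1,\quad \nu_\ell'=\overline\rho+2\overline\Lambda_{\ell-1},\quad \nu_\ell=\overline\rho+2\overline\Lambda_\ell,$$ $$\nu_i=\overline\rho+\overline\Lambda_i\ (1\le i\le\ell-2),\quad \nu_{\ell-1}=\overline\rho+\overline\Lambda_{\ell-1}+\overline\Lambda_\ell,$$ $$\mu_0=\overline\rho+\overline\Lambda_\ell,\quad \mu_1=\overline\rho+\overline\Lambda_{\ell-1},\quad \mu_2=\overline\rho+\overline\Lambda_1+\overline\Lambda_\ell,\quad \mu_3=\overline\rho+\overline\Lambda_1+\overline\Lambda_{\ell-1}.$$ **Theorem.** These $\ell+7$ labels are distinct and are all the elements of $P$. The matrix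 $S$ exists and is unique. The rows of $s$ are pairwise distinct and are exactly the irreducible characters of $D^{(1)}_{\ell,2}$ (that is, $s$ is its character table). With rows and columns in the order $\nu_0,\nu'_0,\nu'_\ell,\nu_\ell\mid\nu_1,\dots,\nu_{\ell-1}\mid\mu_0,\dots,\mu_3$, $$s=\begin{pmatrix}A&B&\sqrt{\ell}\,C\\ B'&(c(ij))_{1\le i,j\le\ell-1}&0\\ C'&0&W_\ell\end{pmatrix},\qquad c(j)=2\cos(\pi j/\ell),$$ where, with $\varepsilon=\mathrm{i}^\ell$ for even $\ell$ and $\varepsilon=-\mathrm{i}^\ell$ for odd $\ell$, $$A=\begin{pmatrix}1&1&1&1\\1&1&1&1\\1&1&(-1)^\ell&(-1)^\ell\\1&1&(-1)^\ell&(-1)^\ell\end{pmatrix},\quad C=\begin{pmatrix}1&1&1&1\\-1&-1&-1&-1\\-\varepsilon&\varepsilon&\varepsilon&-\varepsilon\\ \varepsilon&-\varepsilon&-\varepsilon&\varepsilon\end{pmatrix},\quad C'=\begin{pmatrix}1&-1&-\varepsilon&\varepsilon\\1&-1&\varepsilon&-\varepsilon\\1&-1&\varepsilon&-\varepsilon\\1&-1&-\varepsilon&\varepsilon\end{pmatrix};$$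 the column of $B$ for $\nu_j$ is $(2,2,2(-1)^j,2(-1)^j)^T$, the row of $B'$ for $\nu_i$ is $(1,1,(-1)^i,(-1)^i)$, and, with $\zeta_8=e^{2\pi \mathrm{i}/8}$, $$W_\ell=(\zeta_8^{-ij})_{i,j\in\{1,7,3,5\}}\ \text{if } \ell\equiv1,\qquad W_\ell=(\zeta_8^{ij})_{i,j\in\{1,7,3,5\}}\ \text{if } \ell\equiv3 \pmod 4,$$ $$W_\ell=\sqrt2\begin{pmatrix}0&1&-1&0\\1&0&0&-1\\-1&0&0&1\\0&-1&1&0\end{pmatrix}\ \text{if } \ell\equiv2,\qquad W_\ell=\sqrt2\begin{pmatrix}1&0&0&-1\\0&1&-1&0\\0&-1&1&0\\-1&0&0&1\end{pmatrix}\ \text{if } \ell\equiv0\pmod 4.$$ -/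

import Mathlib

open scoped Matrix

noncomputable section

namespace KacPetersonD

/-- The fundamental weight `Λ̄_j` (`1 ≤ j ≤ ℓ`) of type `D_ℓ`, in coordinates with respect to the
orthonormal basis `v_1, …, v_ℓ` (the coordinate `i : Fin ℓ` belongs to `v_{i+1}`). The simple roots
are `v_i - v_{i+1}` for `1 ≤ i < ℓ` and `v_{ℓ-1} + v_ℓ`. -/
def fundWeight (ℓ j : ℕ) : Fin ℓ → ℝ := fun i =>
  if j + 2 ≤ ℓ then (if (i : ℕ) + 1 ≤ j then 1 else 0)
  else if j + 1 = ℓ then (if (i : ℕ) + 1 = ℓ then -(1 / 2) else 1 / 2)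
  else 1 / 2

/-- The dual Kac label `a_j^∨` (`1 ≤ j ≤ ℓ`) of `D_ℓ^{(1)}`. The remaining one is `a_0^∨ = 1`. -/
def comark (ℓ j : ℕ) : ℕ := if 2 ≤ j ∧ j + 2 ≤ ℓ then 2 else 1

/-- `ρ̄`, the sum of the fundamental weights. -/
def rhoBar (ℓ : ℕ) : Fin ℓ → ℝ := ∑ j ∈ Finset.Icc 1 ℓ, fundWeight ℓ j

/-- The dominant integral weights of level `k` of `D_ℓ^{(1)}`, each represented by its finite part
shifted by `ρ̄`. -/
def levelWeights (ℓ k : ℕ) : Set (Fin ℓ → ℝ) :=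
  {v | ∃ l : ℕ → ℕ, ∑ j ∈ Finset.Icc 1 ℓ, comark ℓ j * l j ≤ k ∧
    v = rhoBar ℓ + ∑ j ∈ Finset.Icc 1 ℓ, (l j : ℝ) • fundWeight ℓ j}

theorem levelWeights_finite (ℓ k : ℕ) : (levelWeights ℓ k).Finite := by
  refine (Set.finite_range (fun m : Fin (ℓ + 1) → Fin (k + 1) => rhoBar ℓ +
    ∑ j ∈ Finset.Icc 1 ℓ,
      (if h : j < ℓ + 1 then ((m ⟨j, h⟩ : ℕ) : ℝ) else 0) • fundWeight ℓ j)).subset ?_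
  rintro v ⟨l, hl, rfl⟩
  refine ⟨fun j => Fin.ofNat (k + 1) (l j), ?_⟩
  dsimp only
  congr 1
  refine Finset.sum_congr rfl fun j hj => ?_
  have hj' : j < ℓ + 1 := by have := (Finset.mem_Icc.mp hj).2; omega
  have h1 : comark ℓ j * l j ≤ k :=
    (Finset.single_le_sum (f := fun j => comark ℓ j * l j) (fun _ _ => Nat.zero_le _) hj).trans hl
  have h2 : l j < k + 1 := by
    unfold comark at h1
    split_ifs at h1 <;> omega
  rw [dif_pos hj']
  simp [Fin.ofNat, Nat.mod_eq_of_lt h2]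

instance (ℓ k : ℕ) : Fintype (levelWeights ℓ k) := (levelWeights_finite ℓ k).fintype

/-- `ρ̄` itself, the label of the vacuum (the unit of the fusion algebra). -/
def vacuum (ℓ k : ℕ) : levelWeights ℓ k := ⟨rhoBar ℓ, fun _ => 0, by simp, by simp⟩

/-- The element of the Weyl group of type `D_ℓ` given by a permutation `σ` and signs `f`, as a
monomial matrix: it maps `v_j` to `f_{σ j} v_{σ j}`. -/
def weylElt {ℓ : ℕ} (p : Equiv.Perm (Fin ℓ) × (Fin ℓ → ℤˣ)) : Matrix (Fin ℓ) (Fin ℓ) ℝ :=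
  Matrix.of fun i j => if p.1 j = i then ((p.2 i : ℤ) : ℝ) else 0

/-- The Weyl group of type `D_ℓ`: all permutations with an even number of sign changes. -/
def weylGroup (ℓ : ℕ) : Finset (Equiv.Perm (Fin ℓ) × (Fin ℓ → ℤˣ)) :=
  Finset.univ.filter fun p => ∏ i, p.2 i = 1

/-- The alternating sum over the Weyl group in the Kac-Peterson formula at level `k`;
the dual Coxeter number is `2ℓ - 2`. -/
def weylSum (ℓ k : ℕ) (a b : Fin ℓ → ℝ) : ℂ :=
  ∑ p ∈ weylGroup ℓ, ((weylElt p).det : ℂ) *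
    Complex.exp (-(2 * (Real.pi : ℂ) * Complex.I * ((a ⬝ᵥ (weylElt p *ᵥ b) : ℝ) : ℂ))
      / ((k : ℂ) + (2 * (ℓ : ℂ) - 2)))

/-- `S` is the Kac-Peterson matrix of `D_ℓ^{(1)}` at level `k`: the matrix of the sums `weylSum`,
multiplied by a constant such that `S` is unitary and such that the row and the column
of the vacuum have positive real entries. -/
def IsKacPeterson (ℓ k : ℕ) (S : Matrix (levelWeights ℓ k) (levelWeights ℓ k) ℂ) : Prop :=
  (∃ c : ℂ, ∀ a b, S a b = c * weylSum ℓ k a b) ∧ Sᴴ * S = 1 ∧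
    (∀ a, ∃ r : ℝ, 0 < r ∧ S a (vacuum ℓ k) = r) ∧
    (∀ a, ∃ r : ℝ, 0 < r ∧ S (vacuum ℓ k) a = r)

section Fusion

/-- The matrix `s_{a,b} = S_{a,b} / S_{a,o}`. -/
def sMatrix {ι : Type*} (S : Matrix ι ι ℂ) (o : ι) : Matrix ι ι ℂ :=
  Matrix.of fun a b => S a b / S a o

/-- Verlinde's formula: the structure constant `N_{ab}^m` of the fusion algebra of `S`,
which has a basis indexed by `ι` with unit `o`. -/
def fusionCoeff {ι : Type*} [Fintype ι] (S : Matrix ι ι ℂ) (o a b m : ι) : ℂ :=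
  ∑ k, S k a * S k b * star (S k m) / S k o

/-- `χ` lists the values, on the basis, of a one-dimensional representation of the fusion
algebra of `S`. -/
def IsFusionCharacter {ι : Type*} [Fintype ι] (S : Matrix ι ι ℂ) (o : ι) (χ : ι → ℂ) : Prop :=
  χ o = 1 ∧ ∀ a b, χ a * χ b = ∑ m, fusionCoeff S o a b m * χ m

/-- `s` is the character table of the fusion algebra of `S`: its rows are pairwise
distinct, and they are all the irreducible characters. -/
def IsCharacterTable {ι : Type*} [Fintype ι] (S : Matrix ι ι ℂ) (o : ι) (s : Matrix ι ι ℂ) :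
    Prop :=
  Function.Injective s.row ∧ Set.range s.row = {χ | IsFusionCharacter S o χ}

end Fusion

/-- The labels at level `2`, in the order
`ν_0, ν'_0, ν'_ℓ, ν_ℓ | ν_1, …, ν_{ℓ-1} | μ_0, μ_1, μ_2, μ_3`. -/
abbrev Label (ℓ : ℕ) : Type := Fin 4 ⊕ (Fin (ℓ - 1) ⊕ Fin 4)

/-- The weight, shifted by `ρ̄`, that belongs to a label. -/
def labelWeight (ℓ : ℕ) : Label ℓ → Fin ℓ → ℝ
  | .inl a => rhoBar ℓ + (![0, (2 : ℝ) • fundWeight ℓ 1, (2 : ℝ) • fundWeight ℓ (ℓ - 1),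
      (2 : ℝ) • fundWeight ℓ ℓ] : Fin 4 → Fin ℓ → ℝ) a
  | .inr (.inl i) => rhoBar ℓ +
      if (i : ℕ) + 1 = ℓ - 1 then fundWeight ℓ (ℓ - 1) + fundWeight ℓ ℓ
      else fundWeight ℓ ((i : ℕ) + 1)
  | .inr (.inr b) => rhoBar ℓ + (![fundWeight ℓ ℓ, fundWeight ℓ (ℓ - 1),
      fundWeight ℓ 1 + fundWeight ℓ ℓ, fundWeight ℓ 1 + fundWeight ℓ (ℓ - 1)] :
        Fin 4 → Fin ℓ → ℝ) b

/-- `ζ_8 = exp(2πi/8)`. -/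
def zeta8 : ℂ := Complex.exp (2 * (Real.pi : ℂ) * Complex.I / 8)

/-- `c(j) = 2 cos(2πj/(2ℓ))`. -/
def cosTwo (ℓ j : ℕ) : ℂ := ((2 * Real.cos (2 * Real.pi * (j : ℝ) / (2 * (ℓ : ℝ))) : ℝ) : ℂ)

/-- `√n` as a complex number. -/
def rt (n : ℕ) : ℂ := ((Real.sqrt (n : ℝ) : ℝ) : ℂ)

/-- The block `W_ℓ`. -/
def blockW (ℓ : ℕ) : Matrix (Fin 4) (Fin 4) ℂ :=
  if ℓ % 4 = 1 then
    Matrix.of fun i j => (zeta8 ^ ((![1, 7, 3, 5] : Fin 4 → ℕ) i * (![1, 7, 3, 5] : Fin 4 → ℕ) j))⁻¹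
  else if ℓ % 4 = 3 then
    Matrix.of fun i j => zeta8 ^ ((![1, 7, 3, 5] : Fin 4 → ℕ) i * (![1, 7, 3, 5] : Fin 4 → ℕ) j)
  else if ℓ % 4 = 2 then
    !![0, rt 2, -rt 2, 0;
       rt 2, 0, 0, -rt 2;
       -rt 2, 0, 0, rt 2;
       0, -rt 2, rt 2, 0]
  else
    !![rt 2, 0, 0, -rt 2;
       0, rt 2, -rt 2, 0;
       0, -rt 2, rt 2, 0;
       -rt 2, 0, 0, rt 2]

/-- `i^ℓ` if `ℓ` is even, and `-i^ℓ` if `ℓ` is odd. -/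
def signedI (ℓ : ℕ) : ℂ := if Even ℓ then Complex.I ^ ℓ else -Complex.I ^ ℓ

/-- The explicit table, with rows and columns in the order of `Label`. -/
def table (ℓ : ℕ) : Matrix (Label ℓ) (Label ℓ) ℂ := Matrix.of fun
  | .inl a, .inl b =>
      !![1, 1, 1, 1;
         1, 1, 1, 1;
         1, 1, (-1) ^ ℓ, (-1) ^ ℓ;
         1, 1, (-1) ^ ℓ, (-1) ^ ℓ] a b
  | .inl a, .inr (.inl j) =>
      (![2, 2, 2 * (-1) ^ ((j : ℕ) + 1), 2 * (-1) ^ ((j : ℕ) + 1)] : Fin 4 → ℂ) a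
  | .inl a, .inr (.inr b) =>
      rt ℓ * !![1, 1, 1, 1;
         -1, -1, -1, -1;
         -signedI ℓ, signedI ℓ, signedI ℓ, -signedI ℓ;
         signedI ℓ, -signedI ℓ, -signedI ℓ, signedI ℓ] a b
  | .inr (.inl i), .inl b =>
      (![1, 1, (-1) ^ ((i : ℕ) + 1), (-1) ^ ((i : ℕ) + 1)] : Fin 4 → ℂ) b
  | .inr (.inl i), .inr (.inl j) => cosTwo ℓ (((i : ℕ) + 1) * ((j : ℕ) + 1))
  | .inr (.inl _), .inr (.inr _) => 0
  | .inr (.inr a), .inl b =>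
      !![1, -1, -signedI ℓ, signedI ℓ;
         1, -1, signedI ℓ, -signedI ℓ;
         1, -1, signedI ℓ, -signedI ℓ;
         1, -1, -signedI ℓ, signedI ℓ] a b
  | .inr (.inr _), .inr (.inl _) => 0
  | .inr (.inr a), .inr (.inr b) => blockW ℓ a b

end KacPetersonD

end

/-! Restricting to an even number of sign changes amounts to averaging over all sign vectors with
the weights 1 and ∏ signs. Since the level plus the dual Coxeter number is 2ℓ, summing over each
sign separately turns the alternating sum into half of det(2 cos(π a_i b_j / ℓ)) + (-i)^ℓ det(2
sin(π a_i b_j / ℓ)) (`weylSum_eq`).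

Up to the reflection x ↦ 2ℓ - x of the first coordinate and the sign change of the last one, every
label is either the sequence ℓ, …, 1, 0 with one entry left out, or ℓ - 1/2, …, 1/2. The reflections
change the two determinants at most by a sign, and coordinates equal to 0 or ℓ produce the zero
blocks.

For two integral sequences the cosine determinants are minors of the (ℓ+1)×(ℓ+1) matrix of the
discrete cosine transform. Its inverse is again a cosine matrix up to endpoint weights, so its
cofactors are cosines (`exists_cosDet_intWeight`). The determinants that involve the half-integral
sequence are known up to sign from orthogonality, and the sign follows by comparing Vandermonde
determinants (`exists_cosDet_scale`). Sines reduce to cosines by a ↦ ℓ - a (`sinDet_halfWeight`).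

Hence all Weyl sums are one scalar times `rowScale` times `table` (`exists_weylSum_labelWeight`).
Orthogonality of the columns (`scaledTable_unitary`) fixes the constant and separates the labels.
That the rows of s are all the characters holds for any unitary matrix whose vacuum column has no
zero (`isCharacterTable_sMatrix`). -/

noncomputable section

namespace KacPetersonD

/-! ### The Weyl sum as a combination of two determinants. -/

/-- The determinant of the matrix `2 cos (π a_i b_j / ℓ)`. -/
def cosDet {ℓ : ℕ} (a b : Fin ℓ → ℝ) : ℝ :=
  (Matrix.of fun i j => 2 * Real.cos (Real.pi * (a i * b j) / ℓ)).det

/-- The determinant of the matrix `2 sin (π a_i b_j / ℓ)`. -/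
def sinDet {ℓ : ℕ} (a b : Fin ℓ → ℝ) : ℝ :=
  (Matrix.of fun i j => 2 * Real.sin (Real.pi * (a i * b j) / ℓ)).det

theorem det_weylElt {ℓ : ℕ} (p : Equiv.Perm (Fin ℓ) × (Fin ℓ → ℤˣ)) :
    (weylElt p).det = ((Equiv.Perm.sign p.1 : ℤ) : ℝ) * ∏ i, (((p.2 i : ℤˣ) : ℤ) : ℝ) := by
  have h : weylElt p = Matrix.of fun i j =>
      (((p.2 i : ℤˣ) : ℤ) : ℝ) * ((1 : Matrix (Fin ℓ) (Fin ℓ) ℝ).submatrix id p.1) i j := by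
    ext i j
    simp only [weylElt, Matrix.of_apply, Matrix.submatrix_apply, id, Matrix.one_apply]
    by_cases h : p.1 j = i
    · simp [h]
    · simp [h, Ne.symm h]
  rw [h, Matrix.det_mul_column, Matrix.det_permute', Matrix.det_one]
  ring

theorem dotProduct_weylElt_mulVec {ℓ : ℕ} (p : Equiv.Perm (Fin ℓ) × (Fin ℓ → ℤˣ))
    (a b : Fin ℓ → ℝ) :
    a ⬝ᵥ (weylElt p *ᵥ b) = ∑ j, (((p.2 (p.1 j) : ℤˣ) : ℤ) : ℝ) * (a (p.1 j) * b j) := by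
  simp only [dotProduct, Matrix.mulVec, weylElt, Matrix.of_apply, Finset.mul_sum]
  rw [Finset.sum_comm]
  refine Finset.sum_congr rfl fun j _ => ?_
  rw [Finset.sum_eq_single (p.1 j)]
  · simp; ring
  · intro i _ hi
    simp [Ne.symm hi]
  · simp

theorem sum_signs_prod {ℓ : ℕ} (g : Fin ℓ → ℤˣ → ℂ) :
    ∑ f : Fin ℓ → ℤˣ, ∏ i, g i (f i) = ∏ i, (g i 1 + g i (-1)) := by
  have h : ∀ i, g i 1 + g i (-1) = ∑ u : ℤˣ, g i u := by
    intro i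
    rw [show (Finset.univ : Finset ℤˣ) = {1, -1} from by decide, Finset.sum_pair (by decide)]
  simp only [h]
  exact (Fintype.prod_sum g).symm

theorem weylSum_eq (ℓ : ℕ) (a b : Fin ℓ → ℝ) :
    weylSum ℓ 2 a b = (1 / 2) * ((cosDet a b : ℂ) + (-Complex.I) ^ ℓ * (sinDet a b : ℂ)) := by
  set t : Fin ℓ → Fin ℓ → ℂ := fun i j => ((Real.pi * (a i * b j) / ℓ : ℝ) : ℂ) with ht
  have hterm : ∀ p : Equiv.Perm (Fin ℓ) × (Fin ℓ → ℤˣ),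
      Complex.exp (-(2 * (Real.pi : ℂ) * Complex.I * ((a ⬝ᵥ (weylElt p *ᵥ b) : ℝ) : ℂ))
        / (((2 : ℕ) : ℂ) + (2 * (ℓ : ℂ) - 2))) =
      ∏ j, Complex.exp (-((((p.2 (p.1 j) : ℤˣ) : ℤ) : ℂ) * t (p.1 j) j * Complex.I)) := by
    intro p
    rw [dotProduct_weylElt_mulVec, ← Complex.exp_sum]
    congr 1
    push_cast
    rw [Finset.mul_sum, ← Finset.sum_neg_distrib, Finset.sum_div]
    refine Finset.sum_congr rfl fun j _ => ?_
    simp only [ht]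
    push_cast
    by_cases h0 : (ℓ : ℂ) = 0
    · simp [h0]
    · have : (2 : ℂ) + (2 * (ℓ : ℂ) - 2) = 2 * ℓ := by ring
      rw [this]
      field_simp
  -- Replacing f by f ∘ σ⁻¹ decouples the signs from the permutation, so the sum factors over the
  -- coordinates.
  have hperm : ∀ (σ : Equiv.Perm (Fin ℓ)) (h : Fin ℓ → ℤˣ → ℂ),
      ∑ f : Fin ℓ → ℤˣ, ∏ j, h j (f (σ j)) = ∏ j, (h j 1 + h j (-1)) := by
    intro σ h
    rw [← sum_signs_prod]
    exact Fintype.sum_equiv (Equiv.arrowCongr σ.symm (Equiv.refl _)) _ _ (fun f => by simp)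
  have hexp : ∀ x : ℂ, Complex.exp (-(x * Complex.I)) + Complex.exp (x * Complex.I) =
      2 * Complex.cos x := by
    intro x; rw [Complex.cos, neg_mul]; ring
  have hexp' : ∀ x : ℂ, Complex.exp (-(x * Complex.I)) - Complex.exp (x * Complex.I) =
      -Complex.I * (2 * Complex.sin x) := by
    intro x; rw [Complex.sin, neg_mul]; ring_nf; rw [Complex.I_sq]; ring
  unfold weylSum weylGroup
  rw [Finset.sum_filter]
  -- The filter becomes the factor (1 + ∏ signs) / 2. Where it is nonzero, ∏ signs = 1, so the
  -- determinant of the monomial matrix is just the sign of the permutation.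
  have hstep : ∀ p : Equiv.Perm (Fin ℓ) × (Fin ℓ → ℤˣ),
      (if ∏ i, p.2 i = 1 then ((weylElt p).det : ℂ) *
        Complex.exp (-(2 * (Real.pi : ℂ) * Complex.I * ((a ⬝ᵥ (weylElt p *ᵥ b) : ℝ) : ℂ))
        / (((2 : ℕ) : ℂ) + (2 * (ℓ : ℂ) - 2))) else 0) =
      (1 / 2) * ((Equiv.Perm.sign p.1 : ℤ) : ℂ) *
        (∏ j, Complex.exp (-((((p.2 (p.1 j) : ℤˣ) : ℤ) : ℂ) * t (p.1 j) j * Complex.I)) +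
         ∏ j, (((p.2 (p.1 j) : ℤˣ) : ℤ) : ℂ) *
          Complex.exp (-((((p.2 (p.1 j) : ℤˣ) : ℤ) : ℂ) * t (p.1 j) j * Complex.I))) := by
    intro p
    rw [hterm, det_weylElt, Finset.prod_mul_distrib,
      Equiv.prod_comp p.1 (fun i => (((p.2 i : ℤˣ) : ℤ) : ℂ))]
    have hc : ∏ i, (((p.2 i : ℤˣ) : ℤ) : ℂ) = (((∏ i, p.2 i : ℤˣ) : ℤ) : ℂ) := by
      push_cast; rfl
    push_cast
    rw [hc]
    rcases Int.units_eq_one_or (∏ i, p.2 i) with h | h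
    · rw [h]; simp; ring
    · rw [h]; simp
  rw [Finset.sum_congr rfl fun p _ => hstep p, Fintype.sum_prod_type]
  have hσ : ∀ σ : Equiv.Perm (Fin ℓ), ∑ f : Fin ℓ → ℤˣ,
      (1 / 2) * ((Equiv.Perm.sign σ : ℤ) : ℂ) *
        (∏ j, Complex.exp (-((((f (σ j) : ℤˣ) : ℤ) : ℂ) * t (σ j) j * Complex.I)) +
         ∏ j, (((f (σ j) : ℤˣ) : ℤ) : ℂ) *
          Complex.exp (-((((f (σ j) : ℤˣ) : ℤ) : ℂ) * t (σ j) j * Complex.I))) =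
      (1 / 2) * (((Equiv.Perm.sign σ : ℤ) : ℂ) * ∏ j, (2 * Complex.cos (t (σ j) j)) +
        (-Complex.I) ^ ℓ *
          (((Equiv.Perm.sign σ : ℤ) : ℂ) * ∏ j, (2 * Complex.sin (t (σ j) j)))) := by
    intro σ
    rw [← Finset.mul_sum, Finset.sum_add_distrib,
      hperm σ (fun j u => Complex.exp (-(((u : ℤ) : ℂ) * t (σ j) j * Complex.I))),
      hperm σ (fun j u => ((u : ℤ) : ℂ) *
        Complex.exp (-(((u : ℤ) : ℂ) * t (σ j) j * Complex.I)))]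
    have e1 : ∏ j, (-Complex.I * (2 * Complex.sin (t (σ j) j))) =
        (-Complex.I) ^ ℓ * ∏ j, (2 * Complex.sin (t (σ j) j)) := by
      rw [Finset.prod_mul_distrib]; simp
    have e2 : ∀ j, Complex.exp (-((((1 : ℤˣ) : ℤ) : ℂ) * t (σ j) j * Complex.I)) +
        Complex.exp (-((((-1 : ℤˣ) : ℤ) : ℂ) * t (σ j) j * Complex.I)) =
        2 * Complex.cos (t (σ j) j) := by
      intro j; rw [← hexp]; simp
    have e3 : ∀ j, (((1 : ℤˣ) : ℤ) : ℂ) *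
        Complex.exp (-((((1 : ℤˣ) : ℤ) : ℂ) * t (σ j) j * Complex.I)) +
        (((-1 : ℤˣ) : ℤ) : ℂ) * Complex.exp (-((((-1 : ℤˣ) : ℤ) : ℂ) * t (σ j) j * Complex.I)) =
        -Complex.I * (2 * Complex.sin (t (σ j) j)) := by
      intro j; rw [← hexp']; simp; ring
    rw [Finset.prod_congr rfl fun j _ => e2 j, Finset.prod_congr rfl fun j _ => e3 j, e1]
    ring
  rw [Finset.sum_congr rfl fun σ _ => hσ σ, ← Finset.mul_sum, Finset.sum_add_distrib,
    ← Finset.mul_sum]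
  unfold cosDet sinDet
  rw [Matrix.det_apply', Matrix.det_apply']
  simp [ht]

/-! ### Orthogonality of discrete cosine transforms. -/

section TrigonometricSums

/-- The sum telescopes: 2 sin(x/2) cos((j + 1/2)x) = sin((j + 1)x) - sin(jx). -/
theorem two_sin_half_mul_sum_cos (x : ℝ) (n : ℕ) :
    2 * Real.sin (x / 2) * ∑ j ∈ Finset.range n, Real.cos (((j : ℝ) + 1 / 2) * x) =
      Real.sin (n * x) := by
  induction n with
  | zero => simp
  | succ n ih =>
    rw [Finset.sum_range_succ, mul_add, ih]
    have h1 : ((n : ℝ) + 1 / 2) * x = n * x + x / 2 := by ring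
    have h2 : ((n + 1 : ℕ) : ℝ) * x = n * x + 2 * (x / 2) := by push_cast; ring
    rw [h1, h2, Real.cos_add, Real.sin_add, Real.sin_two_mul, Real.cos_two_mul, Real.cos_sq']
    ring

/-- At x = πm/n the telescoped sum is sin(mπ) = 0, while 0 < |m| < 2n keeps sin(x/2) away from zero.
-/
theorem sum_cos_half_eq_zero {n : ℕ} {m : ℤ} (hm : m ≠ 0) (hmn : |m| < 2 * n) :
    ∑ j ∈ Finset.range n, Real.cos (((j : ℝ) + 1 / 2) * (Real.pi * m / n)) = 0 := by
  have hn : (0 : ℝ) < n := by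
    have : (0 : ℤ) < n := by have := abs_nonneg m; omega
    exact_mod_cast this
  have h := two_sin_half_mul_sum_cos (Real.pi * m / n) n
  have h1 : (n : ℝ) * (Real.pi * m / n) = m * Real.pi := by field_simp
  rw [h1, Real.sin_int_mul_pi] at h
  have h2 : Real.sin (Real.pi * m / n / 2) ≠ 0 := by
    have hlt : |(m : ℝ)| < 2 * n := by exact_mod_cast hmn
    rw [abs_lt] at hlt
    have e : Real.pi * m / n / 2 = Real.pi * (m / (2 * n)) := by field_simp
    have hm' : (m : ℝ) ≠ 0 := by exact_mod_cast hm
    rw [e, Ne, Real.sin_eq_zero_iff_of_lt_of_lt]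
    · have := Real.pi_ne_zero
      positivity
    · have : -1 < (m : ℝ) / (2 * n) := by rw [lt_div_iff₀ (by positivity)]; linarith
      nlinarith [Real.pi_pos]
    · have : (m : ℝ) / (2 * n) < 1 := by rw [div_lt_iff₀ (by positivity)]; linarith
      nlinarith [Real.pi_pos]
  have h3 : 2 * Real.sin (Real.pi * m / n / 2) ≠ 0 := mul_ne_zero two_ne_zero h2
  exact (mul_eq_zero.mp h).resolve_left h3

/-- The weights `1/2, 1, …, 1, 1/2` of the trapezoidal rule with nodes `0, …, n`. -/
def trapWeight (n p : ℕ) : ℝ := if p = 0 ∨ p = n then 1 / 2 else 1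

theorem sum_trapWeight_mul {n : ℕ} (hn : 0 < n) (f : ℕ → ℝ) :
    ∑ p ∈ Finset.range (n + 1), trapWeight n p * f p =
      ∑ j ∈ Finset.range n, (f j + f (j + 1)) / 2 := by
  obtain ⟨k, rfl⟩ : ∃ k, n = k + 1 := ⟨n - 1, by omega⟩
  have h : ∀ j ∈ Finset.range k, trapWeight (k + 1) (j + 1) * f (j + 1) = f (j + 1) := by
    intro j hj
    have := Finset.mem_range.mp hj
    rw [trapWeight, if_neg (by omega), one_mul]
  rw [Finset.sum_range_succ, Finset.sum_range_succ', Finset.sum_congr rfl h,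
    ← Finset.sum_div, Finset.sum_add_distrib, Finset.sum_range_succ (fun j => f (j + 1)),
    Finset.sum_range_succ']
  simp [trapWeight]
  ring

/-- The average of the values at two neighbouring nodes is cos(x/2) times the value at their
midpoint, which reduces the claim to the midpoint sum. -/
theorem sum_trapWeight_cos_eq_zero {n : ℕ} {m : ℤ} (hm : m ≠ 0) (hmn : |m| < 2 * n) :
    ∑ p ∈ Finset.range (n + 1), trapWeight n p * Real.cos ((p : ℝ) * (Real.pi * m / n)) = 0 := by
  have hn : 0 < n := by have := abs_nonneg m; omega
  rw [sum_trapWeight_mul hn (fun p => Real.cos ((p : ℝ) * (Real.pi * m / n)))]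
  have h : ∀ j ∈ Finset.range n, (Real.cos ((j : ℝ) * (Real.pi * m / n)) +
      Real.cos (((j + 1 : ℕ) : ℝ) * (Real.pi * m / n))) / 2 =
      Real.cos (Real.pi * m / n / 2) * Real.cos (((j : ℝ) + 1 / 2) * (Real.pi * m / n)) := by
    intro j _
    set x := Real.pi * m / n
    have h1 : (j : ℝ) * x = (j + 1 / 2) * x - x / 2 := by ring
    have h2 : ((j + 1 : ℕ) : ℝ) * x = (j + 1 / 2) * x + x / 2 := by push_cast; ring
    rw [h1, h2, Real.cos_add, Real.cos_sub]
    ring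
  rw [Finset.sum_congr rfl h, ← Finset.mul_sum, sum_cos_half_eq_zero hm hmn, mul_zero]

theorem sum_trapWeight {n : ℕ} (hn : 0 < n) :
    ∑ p ∈ Finset.range (n + 1), trapWeight n p = n := by
  have := sum_trapWeight_mul hn (fun _ => 1)
  simpa using this

/-- Orthogonality of the discrete cosine transform of type I. -/
theorem sum_trapWeight_cos_mul_cos {n a b : ℕ} (hn : 0 < n) (ha : a ≤ n) (hb : b ≤ n) :
    ∑ p ∈ Finset.range (n + 1), trapWeight n p *
      (2 * Real.cos (Real.pi * (a * p) / n) * (2 * Real.cos (Real.pi * (p * b) / n))) =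
      if a = b then 2 * n / trapWeight n a else 0 := by
  have hn' : (n : ℝ) ≠ 0 := by positivity
  have h : ∀ p ∈ Finset.range (n + 1), trapWeight n p *
      (2 * Real.cos (Real.pi * (a * p) / n) * (2 * Real.cos (Real.pi * (p * b) / n))) =
      2 * (trapWeight n p * Real.cos ((p : ℝ) * (Real.pi * ((a + b : ℤ) : ℝ) / n))) +
      2 * (trapWeight n p * Real.cos ((p : ℝ) * (Real.pi * ((a - b : ℤ) : ℝ) / n))) := by
    intro p _
    have h1 : (p : ℝ) * (Real.pi * ((a + b : ℤ) : ℝ) / n) =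
      Real.pi * (a * p) / n + Real.pi * (p * b) / n := by push_cast; ring
    have h2 : (p : ℝ) * (Real.pi * ((a - b : ℤ) : ℝ) / n) =
      Real.pi * (a * p) / n - Real.pi * (p * b) / n := by push_cast; ring
    rw [h1, h2, Real.cos_add, Real.cos_sub]
    ring
  rw [Finset.sum_congr rfl h, Finset.sum_add_distrib, ← Finset.mul_sum, ← Finset.mul_sum]
  split_ifs with hab
  · subst hab
    have e1 : ∑ p ∈ Finset.range (n + 1), trapWeight n p *
        Real.cos ((p : ℝ) * (Real.pi * ((a - a : ℤ) : ℝ) / n)) = n := by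
      simpa using sum_trapWeight hn
    rw [e1]
    -- At the two ends the frequency a + a is 0 or 2n, so the first sum contributes n as well; this
    -- doubling is the factor 1 / `trapWeight`.
    by_cases h0 : a = 0 ∨ a = n
    · have e2 : ∑ p ∈ Finset.range (n + 1), trapWeight n p *
          Real.cos ((p : ℝ) * (Real.pi * ((a + a : ℤ) : ℝ) / n)) = n := by
        refine (Finset.sum_congr rfl fun p _ => ?_).trans (sum_trapWeight hn)
        rcases h0 with h0 | h0
        · simp [h0]
        · have : (p : ℝ) * (Real.pi * ((a + a : ℤ) : ℝ) / n) = p * (2 * Real.pi) := by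
            rw [h0]; push_cast; field_simp; ring
          rw [this, Real.cos_nat_mul_two_pi, mul_one]
      rw [e2, trapWeight, if_pos h0]
      ring
    · rw [sum_trapWeight_cos_eq_zero (by omega) (by rw [abs_lt]; omega), trapWeight, if_neg h0]
      ring
  · rw [sum_trapWeight_cos_eq_zero (by omega) (by rw [abs_lt]; omega),
      sum_trapWeight_cos_eq_zero (by omega) (by rw [abs_lt]; omega)]
    ring

/-- Orthogonality of the discrete cosine transforms of types III and IV, written for two real
numbers whose sum and difference are integers. -/
theorem sum_cos_half_mul_cos_half {n : ℕ} {a b : ℝ} {s d : ℤ} (hs : a + b = s)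
    (hd : a - b = d) (hsn : |s| < 2 * n) (hdn : |d| < 2 * n) :
    ∑ j ∈ Finset.range n, 2 * Real.cos (Real.pi * (a * ((j : ℝ) + 1 / 2)) / n) *
      (2 * Real.cos (Real.pi * (b * ((j : ℝ) + 1 / 2)) / n)) =
      (if s = 0 then 2 * (n : ℝ) else 0) + (if d = 0 then 2 * (n : ℝ) else 0) := by
  have h : ∀ j ∈ Finset.range n, 2 * Real.cos (Real.pi * (a * ((j : ℝ) + 1 / 2)) / n) *
      (2 * Real.cos (Real.pi * (b * ((j : ℝ) + 1 / 2)) / n)) =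
      2 * Real.cos (((j : ℝ) + 1 / 2) * (Real.pi * (s : ℝ) / n)) +
      2 * Real.cos (((j : ℝ) + 1 / 2) * (Real.pi * (d : ℝ) / n)) := by
    intro j _
    have h1 : ((j : ℝ) + 1 / 2) * (Real.pi * (s : ℝ) / n) =
      Real.pi * (a * ((j : ℝ) + 1 / 2)) / n + Real.pi * (b * ((j : ℝ) + 1 / 2)) / n := by
        rw [← hs]; ring
    have h2 : ((j : ℝ) + 1 / 2) * (Real.pi * (d : ℝ) / n) =
      Real.pi * (a * ((j : ℝ) + 1 / 2)) / n - Real.pi * (b * ((j : ℝ) + 1 / 2)) / n := by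
        rw [← hd]; ring
    rw [h1, h2, Real.cos_add, Real.cos_sub]
    ring
  have key : ∀ m : ℤ, |m| < 2 * n →
      2 * ∑ j ∈ Finset.range n, Real.cos (((j : ℝ) + 1 / 2) * (Real.pi * (m : ℝ) / n)) =
        if m = 0 then 2 * (n : ℝ) else 0 := by
    intro m hm
    split_ifs with h0
    · simp [h0]
    · rw [sum_cos_half_eq_zero h0 hm, mul_zero]
  rw [Finset.sum_congr rfl h, Finset.sum_add_distrib, ← Finset.mul_sum, ← Finset.mul_sum,
    key s hsn, key d hdn]

end TrigonometricSums

/-! ### Signs of cosine determinants through Vandermonde determinants. -/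

section Signs

-- A Chebyshev argument: the three-term recursion produces monic polynomials in 2 cos θ. The factor
-- s is shared by all F k, and r allows for the leading term 2 cos 0 = 2 of the integral cosines.
open Polynomial in
theorem exists_monic_of_cos_recursion {F : ℕ → ℝ → ℝ} {s : ℝ → ℝ} {r c : ℝ}
    (h0 : ∀ θ, F 0 θ = r * s θ) (h1 : ∀ θ, F 1 θ = s θ * (2 * Real.cos θ + c))
    (hrec : ∀ k θ, F (k + 2) θ = 2 * Real.cos θ * F (k + 1) θ - F k θ) (k : ℕ) :
    ∃ p : ℝ[X], p.natDegree = k ∧ p.Monic ∧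
      ∀ θ, F k θ = (if k = 0 then r else 1) * s θ * p.eval (2 * Real.cos θ) := by
  induction k using Nat.strong_induction_on with
  | _ k ih =>
    match k, ih with
    | 0, _ => exact ⟨1, by simp, monic_one, fun θ => by simp [h0]⟩
    | 1, _ => exact ⟨X + C c, natDegree_X_add_C c, monic_X_add_C c, fun θ => by simp [h1]⟩
    | k + 2, ih =>
      obtain ⟨p, hp, hpm, hpe⟩ := ih (k + 1) (by omega)
      obtain ⟨q, hq, hqm, hqe⟩ := ih k (by omega)
      have hd : (X * p).natDegree = k + 2 := by
        rw [natDegree_X_mul hpm.ne_zero, hp]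
      have hlt : (C (if k = 0 then r else 1) * q).natDegree < (X * p).natDegree := by
        rw [hd]
        exact (natDegree_C_mul_le _ _).trans_lt (by omega)
      refine ⟨X * p - C (if k = 0 then r else 1) * q, ?_, ?_, ?_⟩
      · rw [natDegree_sub_eq_left_of_natDegree_lt hlt, hd]
      · exact (monic_X.mul hpm).sub_of_left (degree_lt_degree hlt)
      · intro θ
        rw [hrec, hpe, hqe, if_neg k.succ_ne_zero, if_neg (Nat.succ_ne_zero _), eval_sub, eval_mul,
          eval_mul, eval_X, eval_C]
        ring

theorem det_cos_recursion {F : ℕ → ℝ → ℝ} {s : ℝ → ℝ} {r c : ℝ}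
    (h0 : ∀ θ, F 0 θ = r * s θ) (h1 : ∀ θ, F 1 θ = s θ * (2 * Real.cos θ + c))
    (hrec : ∀ k θ, F (k + 2) θ = 2 * Real.cos θ * F (k + 1) θ - F k θ) {n : ℕ}
    (θ : Fin n → ℝ) :
    (Matrix.of fun i j : Fin n => F i (θ j)).det =
      (∏ i : Fin n, if (i : ℕ) = 0 then r else 1) * ((∏ j, s (θ j)) *
        (Matrix.vandermonde fun j => 2 * Real.cos (θ j)).det) := by
  choose p hp hpm hpe using exists_monic_of_cos_recursion h0 h1 hrec
  rw [Matrix.det_eval_matrixOfPolynomials_eq_det_vandermonde (fun j => 2 * Real.cos (θ j))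
    (fun i => p i) (fun i => hp i) (fun i => hpm i), ← Matrix.det_transpose (Matrix.of _),
    ← Matrix.det_mul_column, ← Matrix.det_mul_row]
  congr 1
  ext i j
  simp only [Matrix.of_apply, Matrix.transpose_apply, hpe]
  ring

/-- Every factor of either Vandermonde product is negative, so the two products have the same number
of sign changes. This gives relative signs without computing either determinant. -/
theorem det_vandermonde_mul_det_vandermonde_pos {n : ℕ} {v w : Fin n → ℝ} (hv : StrictAnti v)
    (hw : StrictAnti w) : 0 < (Matrix.vandermonde v).det * (Matrix.vandermonde w).det := by
  rw [Matrix.det_vandermonde, Matrix.det_vandermonde, ← Finset.prod_mul_distrib]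
  refine Finset.prod_pos fun i _ => ?_
  rw [← Finset.prod_mul_distrib]
  refine Finset.prod_pos fun j hj => ?_
  have hij : i < j := Finset.mem_Ioi.mp hj
  exact mul_pos_of_neg_of_neg (sub_neg.mpr (hv hij)) (sub_neg.mpr (hw hij))

end Signs

/-! ### Evaluation of the cosine determinants. -/

section Determinants

theorem cosDet_comm {ℓ : ℕ} (a b : Fin ℓ → ℝ) : cosDet a b = cosDet b a := by
  unfold cosDet
  rw [← Matrix.det_transpose]
  congr 1
  ext i j
  simp [mul_comm (a j)]

theorem sinDet_comm {ℓ : ℕ} (a b : Fin ℓ → ℝ) : sinDet a b = sinDet b a := by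
  unfold sinDet
  rw [← Matrix.det_transpose]
  congr 1
  ext i j
  simp [mul_comm (a j)]

theorem cosDet_comp_rev {ℓ : ℕ} (a b : Fin ℓ → ℝ) :
    cosDet (fun i => a i.rev) (fun i => b i.rev) = cosDet a b := by
  unfold cosDet
  exact Matrix.det_submatrix_equiv_self Fin.revPerm
    (Matrix.of fun i j => 2 * Real.cos (Real.pi * (a i * b j) / ℓ))

/-- The increasing sequence `0, 1, …, ℓ - 1`. -/
def intSeq (ℓ : ℕ) : Fin ℓ → ℝ := fun i => (i : ℕ)

/-- The increasing sequence `1/2, 3/2, …, ℓ - 1/2`. -/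
def halfSeq (ℓ : ℕ) : Fin ℓ → ℝ := fun i => (i : ℕ) + 1 / 2

theorem strictAnti_two_cos {ℓ : ℕ} {x : Fin ℓ → ℝ} (hx : StrictMono x) (h0 : ∀ i, 0 ≤ x i)
    (h1 : ∀ i, x i ≤ ℓ) : StrictAnti fun j => 2 * Real.cos (Real.pi * x j / ℓ) := by
  intro i j hij
  have hℓ : (0 : ℝ) < ℓ := by exact_mod_cast i.pos
  have hlt : Real.pi * x i / ℓ < Real.pi * x j / ℓ := by
    have := hx hij
    have := Real.pi_pos
    gcongr
  have hj : Real.pi * x j / ℓ ≤ Real.pi := by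
    rw [div_le_iff₀ hℓ]
    exact mul_le_mul_of_nonneg_left (h1 j) Real.pi_pos.le
  have hi : 0 ≤ Real.pi * x i / ℓ := by
    have := h0 i
    have := Real.pi_pos
    positivity
  have := Real.cos_lt_cos_of_nonneg_of_le_pi hi hj hlt
  simpa using this

theorem intSeq_strictMono (ℓ : ℕ) : StrictMono (intSeq ℓ) := by
  intro i j hij
  simpa [intSeq] using hij

theorem halfSeq_strictMono (ℓ : ℕ) : StrictMono (halfSeq ℓ) := by
  intro i j hij
  simpa [halfSeq] using hij

theorem intSeq_nonneg {ℓ : ℕ} (i : Fin ℓ) : 0 ≤ intSeq ℓ i := by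
  unfold intSeq; positivity

theorem halfSeq_pos {ℓ : ℕ} (i : Fin ℓ) : 0 < halfSeq ℓ i := by
  unfold halfSeq; positivity

theorem intSeq_le {ℓ : ℕ} (i : Fin ℓ) : intSeq ℓ i ≤ ℓ := by
  unfold intSeq; exact_mod_cast i.isLt.le

theorem halfSeq_lt {ℓ : ℕ} (i : Fin ℓ) : halfSeq ℓ i < ℓ := by
  have : ((i : ℕ) : ℝ) + 1 ≤ ℓ := by exact_mod_cast i.isLt
  unfold halfSeq
  linarith

theorem cosDet_intSeq_eq (ℓ : ℕ) : ∃ r : ℝ, 0 < r ∧ ∀ x : Fin ℓ → ℝ,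
    cosDet (intSeq ℓ) x =
      r * (Matrix.vandermonde fun j => 2 * Real.cos (Real.pi * x j / ℓ)).det := by
  refine ⟨∏ i : Fin ℓ, if (i : ℕ) = 0 then 2 else 1,
    Finset.prod_pos fun i _ => by split_ifs <;> norm_num, fun x => ?_⟩
  have h := det_cos_recursion (F := fun k θ => 2 * Real.cos (k * θ)) (s := fun _ => 1) (r := 2)
    (c := 0) (by simp) (by simp) (by
      intro k θ
      have h1 : ((k + 2 : ℕ) : ℝ) * θ = ((k + 1 : ℕ) : ℝ) * θ + θ := by push_cast; ring
      have h2 : (k : ℝ) * θ = ((k + 1 : ℕ) : ℝ) * θ - θ := by push_cast; ring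
      simp only [h1, h2, Real.cos_add, Real.cos_sub]
      ring) (fun j => Real.pi * x j / ℓ)
  rw [Finset.prod_const_one, one_mul] at h
  rw [← h]
  unfold cosDet intSeq
  congr 1
  ext i j
  simp only [Matrix.of_apply]
  ring_nf

/-- All the functions cos((k + 1/2)θ) share the factor cos(θ/2), which is positive because every
node θ lies in (0, π). -/
theorem cosDet_halfSeq_eq (ℓ : ℕ) : ∃ r : ℝ, 0 < r ∧ cosDet (halfSeq ℓ) (halfSeq ℓ) =
      r * (Matrix.vandermonde fun j => 2 * Real.cos (Real.pi * halfSeq ℓ j / ℓ)).det := by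
  refine ⟨∏ j, 2 * Real.cos (Real.pi * halfSeq ℓ j / ℓ / 2), ?_, ?_⟩
  · refine Finset.prod_pos fun j _ => ?_
    have hℓ : (0 : ℝ) < ℓ := by exact_mod_cast j.pos
    have hpi := Real.pi_pos
    have hj := halfSeq_pos j
    refine mul_pos two_pos (Real.cos_pos_of_mem_Ioo ⟨?_, ?_⟩)
    · have : 0 < Real.pi * halfSeq ℓ j / ℓ / 2 := by positivity
      linarith
    · have : Real.pi * halfSeq ℓ j / ℓ < Real.pi := by
        rw [div_lt_iff₀ hℓ]
        exact mul_lt_mul_of_pos_left (halfSeq_lt j) hpi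
      linarith
  have h := det_cos_recursion (F := fun k θ => 2 * Real.cos ((k + 1 / 2) * θ))
    (s := fun θ => 2 * Real.cos (θ / 2)) (r := 1) (c := -1) (by
      intro θ; simp; ring_nf) (by
      intro θ
      have h1 : (((1 : ℕ) : ℝ) + 1 / 2) * θ = 3 * (θ / 2) := by push_cast; ring
      have h2 : θ = 2 * (θ / 2) := by ring
      simp only [h1, Real.cos_three_mul]
      conv_rhs => rw [h2]
      rw [Real.cos_two_mul, mul_div_cancel_left₀ _ (two_ne_zero)]
      ring) (by
      intro k θ
      have h1 : (((k + 2 : ℕ) : ℝ) + 1 / 2) * θ = (((k + 1 : ℕ) : ℝ) + 1 / 2) * θ + θ := by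
        push_cast; ring
      have h2 : ((k : ℝ) + 1 / 2) * θ = (((k + 1 : ℕ) : ℝ) + 1 / 2) * θ - θ := by
        push_cast; ring
      simp only [h1, h2, Real.cos_add, Real.cos_sub]
      ring) (fun j => Real.pi * halfSeq ℓ j / ℓ)
  simp only [ite_self, Finset.prod_const_one, one_mul] at h
  rw [← h]
  unfold cosDet
  congr 1
  ext i j
  simp only [Matrix.of_apply]
  rw [show halfSeq ℓ i = ((i : ℕ) : ℝ) + 1 / 2 from rfl]
  ring_nf

theorem cosDet_int_half_mul_int_int_pos (ℓ : ℕ) :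
    0 < cosDet (intSeq ℓ) (halfSeq ℓ) * cosDet (intSeq ℓ) (intSeq ℓ) := by
  obtain ⟨r, hr, h⟩ := cosDet_intSeq_eq ℓ
  rw [h, h]
  have := det_vandermonde_mul_det_vandermonde_pos
    (strictAnti_two_cos (halfSeq_strictMono ℓ) (fun i => (halfSeq_pos i).le)
      (fun i => (halfSeq_lt i).le))
    (strictAnti_two_cos (intSeq_strictMono ℓ) intSeq_nonneg intSeq_le)
  rw [mul_mul_mul_comm]
  positivity

theorem cosDet_int_half_mul_half_half_pos (ℓ : ℕ) :
    0 < cosDet (intSeq ℓ) (halfSeq ℓ) * cosDet (halfSeq ℓ) (halfSeq ℓ) := by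
  obtain ⟨r, hr, h⟩ := cosDet_intSeq_eq ℓ
  obtain ⟨r', hr', h'⟩ := cosDet_halfSeq_eq ℓ
  rw [h, h']
  have := det_vandermonde_mul_det_vandermonde_pos
    (strictAnti_two_cos (halfSeq_strictMono ℓ) (fun i => (halfSeq_pos i).le)
      (fun i => (halfSeq_lt i).le))
    (strictAnti_two_cos (halfSeq_strictMono ℓ) (fun i => (halfSeq_pos i).le)
      (fun i => (halfSeq_lt i).le))
  rw [mul_mul_mul_comm]
  positivity

/-- The rows are orthogonal with squared norm 2ℓ, except that row 0 has 4ℓ; the square is the Gram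
determinant. -/
theorem cosDet_int_half_sq {ℓ : ℕ} (hℓ : 0 < ℓ) :
    cosDet (intSeq ℓ) (halfSeq ℓ) ^ 2 = 2 * (2 * ℓ) ^ ℓ := by
  have key : (Matrix.of fun i j => 2 * Real.cos (Real.pi * (intSeq ℓ i * halfSeq ℓ j) / ℓ)) *
      (Matrix.of fun i j => 2 * Real.cos (Real.pi * (intSeq ℓ i * halfSeq ℓ j) / ℓ))ᵀ =
      Matrix.diagonal fun i : Fin ℓ => (if (i : ℕ) = 0 then 2 else 1) * (2 * (ℓ : ℝ)) := by
    ext i k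
    have h := sum_cos_half_mul_cos_half (n := ℓ) (a := ((i : ℕ) : ℝ)) (b := ((k : ℕ) : ℝ))
      (s := (i : ℤ) + k) (d := (i : ℤ) - k) (by push_cast; ring) (by push_cast; ring)
      (by rw [abs_lt]; omega) (by rw [abs_lt]; omega)
    rw [Finset.sum_range] at h
    rw [Matrix.mul_apply]
    simp only [Matrix.of_apply, Matrix.transpose_apply, intSeq, halfSeq, Matrix.diagonal_apply]
    rw [h]
    by_cases hik : i = k
    · subst hik
      by_cases h0 : (i : ℕ) = 0
      · simp [h0]; ring
      · have : ¬ ((i : ℤ) + i = 0) := by omega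
        simp [h0]
    · have h1 : ¬ ((i : ℕ) : ℤ) + (k : ℕ) = 0 := by
        intro h; apply hik; ext; omega
      have h2 : ¬ ((i : ℕ) : ℤ) - (k : ℕ) = 0 := by
        intro h; apply hik; ext; omega
      rw [if_neg h1, if_neg h2, if_neg hik, add_zero]
  have h := congrArg Matrix.det key
  rw [Matrix.det_mul, Matrix.det_transpose, Matrix.det_diagonal, Finset.prod_mul_distrib] at h
  obtain ⟨n, rfl⟩ : ∃ n, ℓ = n + 1 := ⟨ℓ - 1, by omega⟩
  have h2 : ∏ i : Fin (n + 1), (if (i : ℕ) = 0 then (2 : ℝ) else 1) = 2 := by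
    rw [Fin.prod_univ_succ]; simp
  rw [h2, Finset.prod_const, Finset.card_univ, Fintype.card_fin] at h
  rw [sq]
  exact h

theorem cosDet_half_half_sq (ℓ : ℕ) :
    cosDet (halfSeq ℓ) (halfSeq ℓ) ^ 2 = (2 * ℓ) ^ ℓ := by
  have key : (Matrix.of fun i j => 2 * Real.cos (Real.pi * (halfSeq ℓ i * halfSeq ℓ j) / ℓ)) *
      (Matrix.of fun i j => 2 * Real.cos (Real.pi * (halfSeq ℓ i * halfSeq ℓ j) / ℓ))ᵀ =
      Matrix.diagonal fun _ : Fin ℓ => 2 * (ℓ : ℝ) := by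
    ext i k
    have h := sum_cos_half_mul_cos_half (n := ℓ) (a := ((i : ℕ) : ℝ) + 1 / 2)
      (b := ((k : ℕ) : ℝ) + 1 / 2)
      (s := (i : ℤ) + k + 1) (d := (i : ℤ) - k) (by push_cast; ring) (by push_cast; ring)
      (by rw [abs_lt]; omega) (by rw [abs_lt]; omega)
    rw [Finset.sum_range] at h
    rw [Matrix.mul_apply]
    simp only [Matrix.of_apply, Matrix.transpose_apply, halfSeq, Matrix.diagonal_apply]
    rw [h]
    have h1 : ¬ ((i : ℕ) : ℤ) + (k : ℕ) + 1 = 0 := by omega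
    by_cases hik : i = k
    · subst hik
      simp [h1]
    · have h2 : ¬ ((i : ℕ) : ℤ) - (k : ℕ) = 0 := by
        intro h; apply hik; ext; omega
      rw [if_neg h1, if_neg h2, if_neg hik, add_zero]
  have h := congrArg Matrix.det key
  rw [Matrix.det_mul, Matrix.det_transpose, Matrix.det_diagonal, Finset.prod_const,
    Finset.card_univ, Fintype.card_fin] at h
  rw [sq]
  exact h

/-- The decreasing sequence `ℓ, ℓ - 1, …, 0` with its entry `ℓ - p` left out. -/
def intWeight (ℓ : ℕ) (p : Fin (ℓ + 1)) : Fin ℓ → ℝ := fun k => ℓ - ((p.succAbove k : ℕ) : ℝ)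

/-- The decreasing sequence `ℓ - 1/2, …, 3/2, 1/2`. -/
def halfWeight (ℓ : ℕ) : Fin ℓ → ℝ := fun k => ℓ - 1 / 2 - ((k : ℕ) : ℝ)

theorem intWeight_zero (ℓ : ℕ) : intWeight ℓ 0 = fun i => intSeq ℓ i.rev := by
  ext i
  have : (i : ℕ) + 1 ≤ ℓ := i.isLt
  simp only [intWeight, intSeq, Fin.zero_succAbove, Fin.val_succ, Fin.val_rev]
  rw [Nat.cast_sub this]

theorem halfWeight_eq (ℓ : ℕ) : halfWeight ℓ = fun i => halfSeq ℓ i.rev := by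
  ext i
  have : (i : ℕ) + 1 ≤ ℓ := i.isLt
  simp only [halfWeight, halfSeq, Fin.val_rev]
  rw [Nat.cast_sub this]
  push_cast
  ring

theorem cos_pi_mul_sub_mul_sub {ℓ : ℕ} (hℓ : 0 < ℓ) (a b : ℕ) :
    Real.cos (Real.pi * (((ℓ : ℝ) - a) * (ℓ - b)) / ℓ) =
      (-1) ^ ℓ * (-1) ^ a * (-1) ^ b * Real.cos (Real.pi * (a * b) / ℓ) := by
  have hne : (ℓ : ℝ) ≠ 0 := by positivity
  have h : Real.pi * (((ℓ : ℝ) - a) * (ℓ - b)) / ℓ =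
      Real.pi * (a * b) / ℓ + ((ℓ - a - b : ℤ) : ℝ) * Real.pi := by
    push_cast; field_simp; ring
  rw [h, Real.cos_add_int_mul_pi, zpow_sub₀ (by norm_num), zpow_sub₀ (by norm_num)]
  rcases neg_one_pow_eq_or ℝ a with ha | ha <;> rcases neg_one_pow_eq_or ℝ b with hb | hb <;>
    simp [ha, hb, div_neg]

theorem prod_trapWeight {n : ℕ} (hn : 0 < n) :
    ∏ p : Fin (n + 1), trapWeight n p = 1 / 4 := by
  obtain ⟨k, rfl⟩ : ∃ k, n = k + 1 := ⟨n - 1, by omega⟩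
  rw [Fin.prod_univ_succ, Fin.prod_univ_castSucc]
  have : ∀ i : Fin k, trapWeight (k + 1) (i.castSucc.succ : ℕ) = 1 := by
    intro i
    have := i.isLt
    rw [trapWeight, if_neg]
    simp only [Fin.val_succ, Fin.val_castSucc]
    omega
  rw [Finset.prod_congr rfl fun i _ => this i]
  simp [trapWeight]
  norm_num

/-- Leaving out one entry on each side means taking a minor of the full cosine matrix M on the nodes
ℓ, …, 0. As D M D is 2ℓ times the inverse of M, the adjugate reads off every minor as a weighted
cosine. -/
theorem exists_cosDet_intWeight {ℓ : ℕ} (hℓ : 0 < ℓ) : ∃ g : ℝ, g ^ 2 * ℓ = 8 * (2 * ℓ) ^ ℓ ∧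
    ∀ p q : Fin (ℓ + 1), cosDet (intWeight ℓ p) (intWeight ℓ q) =
      g * (trapWeight ℓ p * trapWeight ℓ q * (2 * Real.cos (Real.pi * ((p : ℕ) * (q : ℕ)) / ℓ))) := by
  have hne : (ℓ : ℝ) ≠ 0 := by positivity
  set M : Matrix (Fin (ℓ + 1)) (Fin (ℓ + 1)) ℝ := Matrix.of fun p q =>
    2 * Real.cos (Real.pi * (((ℓ : ℝ) - (p : ℕ)) * (ℓ - (q : ℕ))) / ℓ) with hM
  set D : Matrix (Fin (ℓ + 1)) (Fin (ℓ + 1)) ℝ := Matrix.diagonal fun p => trapWeight ℓ p with hD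
  have hw : ∀ p, trapWeight ℓ p ≠ 0 := by
    intro p; unfold trapWeight; split_ifs <;> norm_num
  have hMp : ∀ p q, M p q = (-1) ^ ℓ * (-1) ^ (p : ℕ) * (-1) ^ (q : ℕ) *
      (2 * Real.cos (Real.pi * ((p : ℕ) * (q : ℕ)) / ℓ)) := by
    intro p q
    rw [hM, Matrix.of_apply, cos_pi_mul_sub_mul_sub hℓ]
    ring
  have hsq : ∀ k : ℕ, ((-1 : ℝ) ^ k) * (-1) ^ k = 1 := by
    intro k; rw [← mul_pow]; simp
  -- The signs of `hMp` that depend on ℓ and on the summation index q occur squared, which leaves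
  -- the orthogonality of the type I transform.
  have hmul : M * (D * M * D) = (2 * (ℓ : ℝ)) • (1 : Matrix (Fin (ℓ + 1)) (Fin (ℓ + 1)) ℝ) := by
    ext p r
    rw [← Matrix.mul_assoc, hD, Matrix.mul_diagonal, Matrix.mul_apply]
    simp only [Matrix.diagonal_mul]
    have h := sum_trapWeight_cos_mul_cos (n := ℓ) (a := p) (b := r) hℓ (by omega) (by omega)
    rw [Finset.sum_range] at h
    have e : ∑ q : Fin (ℓ + 1), M p q * (trapWeight ℓ q * M q r) =
        (-1) ^ (p : ℕ) * (-1) ^ (r : ℕ) * ∑ q : Fin (ℓ + 1), trapWeight ℓ q *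
      (2 * Real.cos (Real.pi * ((p : ℕ) * (q : ℕ)) / ℓ) *
        (2 * Real.cos (Real.pi * ((q : ℕ) * (r : ℕ)) / ℓ))) := by
      rw [Finset.mul_sum]
      refine Finset.sum_congr rfl fun q _ => ?_
      rw [hMp, hMp]
      linear_combination ((-1) ^ (p : ℕ) * (-1) ^ (r : ℕ) * trapWeight ℓ q *
      (2 * Real.cos (Real.pi * ((p : ℕ) * (q : ℕ)) / ℓ) *
        (2 * Real.cos (Real.pi * ((q : ℕ) * (r : ℕ)) / ℓ)))) *
          ((-1) ^ (q : ℕ) * (-1) ^ (q : ℕ) * hsq ℓ + hsq q)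
    rw [e, h]
    by_cases hpr : p = r
    · subst hpr
      have := hw p
      simp [hsq]
      field_simp
    · have : ¬ (p : ℕ) = r := fun h => hpr (Fin.ext h)
      simp [hpr, this]
  have hadj : M.adjugate = (M.det / (2 * ℓ)) • (D * M * D) := by
    have h : M.adjugate * (M * (D * M * D)) = M.adjugate * ((2 * (ℓ : ℝ)) • 1) := by rw [hmul]
    rw [← Matrix.mul_assoc, Matrix.adjugate_mul, Matrix.smul_mul, Matrix.one_mul,
      Matrix.mul_smul, Matrix.mul_one] at h
    rw [div_eq_inv_mul, mul_smul, h, smul_smul, inv_mul_cancel₀ (by positivity), one_smul]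
  -- The cofactor sign (-1)^(p+q) cancels the same sign in M p q, so only (-1)^ℓ remains. The value
  -- of g² comes from det M² · det D² = (2ℓ)^(ℓ+1) with det D = 1/4.
  refine ⟨M.det * (-1) ^ ℓ / (2 * ℓ), ?_, ?_⟩
  · have h := congrArg Matrix.det hmul
    rw [Matrix.det_mul, Matrix.det_mul, Matrix.det_mul, hD, Matrix.det_diagonal,
      prod_trapWeight hℓ, Matrix.det_smul, Matrix.det_one, Fintype.card_fin, pow_succ] at h
    have h2 : M.det ^ 2 = 16 * ((2 * (ℓ : ℝ)) ^ ℓ * (2 * ℓ)) := by linarith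
    have h3 : (M.det * (-1) ^ ℓ / (2 * ℓ)) ^ 2 * (ℓ : ℝ) = M.det ^ 2 / (4 * ℓ) := by
      rw [div_pow, mul_pow, ← pow_mul, mul_comm ℓ 2, pow_mul]
      field_simp
      ring
    rw [h3, h2]
    field_simp
    ring
  · intro p q
    have h := Matrix.adjugate_fin_succ_eq_det_submatrix M q p
    have e : (M.submatrix p.succAbove q.succAbove).det =
        cosDet (intWeight ℓ p) (intWeight ℓ q) := rfl
    rw [e, hadj, Matrix.smul_apply, hD, Matrix.mul_diagonal, Matrix.diagonal_mul, hMp,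
      smul_eq_mul, pow_add] at h
    have h1 := hsq p
    have h2 := hsq q
    calc cosDet (intWeight ℓ p) (intWeight ℓ q)
        = ((-1) ^ (p : ℕ) * (-1) ^ (p : ℕ)) * ((-1) ^ (q : ℕ) * (-1) ^ (q : ℕ)) *
          cosDet (intWeight ℓ p) (intWeight ℓ q) := by rw [h1, h2]; ring
      _ = (-1) ^ (p : ℕ) * (-1) ^ (q : ℕ) * ((-1) ^ (p : ℕ) * (-1) ^ (q : ℕ) *
          cosDet (intWeight ℓ p) (intWeight ℓ q)) := by ring
      _ = ((-1) ^ (p : ℕ) * (-1) ^ (p : ℕ)) * ((-1) ^ (q : ℕ) * (-1) ^ (q : ℕ)) *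
          (M.det * (-1) ^ ℓ / (2 * ℓ) * (trapWeight ℓ p * trapWeight ℓ q *
            (2 * Real.cos (Real.pi * ((q : ℕ) * (p : ℕ)) / ℓ)))) := by rw [← h]; ring
      _ = _ := by rw [h1, h2, one_mul, one_mul, mul_comm ((q : ℕ) : ℝ)]

/-- All determinants that are needed are multiples of a single one. -/
theorem exists_cosDet_scale {ℓ : ℕ} (hℓ : 0 < ℓ) : ∃ m : ℝ, m ≠ 0 ∧
    (∀ p q : Fin (ℓ + 1), cosDet (intWeight ℓ p) (intWeight ℓ q) =
      m * (trapWeight ℓ p * trapWeight ℓ q *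
        (4 * Real.cos (Real.pi * ((p : ℕ) * (q : ℕ)) / ℓ)))) ∧
    cosDet (intWeight ℓ 0) (halfWeight ℓ) = m * Real.sqrt ℓ ∧
    cosDet (halfWeight ℓ) (halfWeight ℓ) = m * Real.sqrt ℓ / Real.sqrt 2 := by
  have hℓ' : (0 : ℝ) < ℓ := by positivity
  obtain ⟨g, hg, h⟩ := exists_cosDet_intWeight hℓ
  have h00 : cosDet (intSeq ℓ) (intSeq ℓ) = g / 2 := by
    rw [← cosDet_comp_rev, ← intWeight_zero, h]
    simp [trapWeight]
    ring
  have hK := cosDet_int_half_mul_int_int_pos ℓ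
  have hQ := cosDet_int_half_mul_half_half_pos ℓ
  have hK2 := cosDet_int_half_sq hℓ
  have hQ2 := cosDet_half_half_sq ℓ
  rw [intWeight_zero, halfWeight_eq, cosDet_comp_rev, cosDet_comp_rev]
  rw [h00] at hK
  set K := cosDet (intSeq ℓ) (halfSeq ℓ)
  set Q := cosDet (halfSeq ℓ) (halfSeq ℓ)
  -- The Gram determinants give the squares and the Vandermonde comparison gives positive products;
  -- together they give the values.
  have aux : ∀ {x y : ℝ}, 0 < x * y → x ^ 2 = y ^ 2 → x = y := by
    intro x y hxy h
    rcases sq_eq_sq_iff_eq_or_eq_neg.mp h with h | h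
    · exact h
    · rw [h] at hxy; nlinarith [sq_nonneg y]
  have hsq : Real.sqrt ℓ ^ 2 = ℓ := Real.sq_sqrt hℓ'.le
  have hs2 : Real.sqrt 2 ^ 2 = 2 := Real.sq_sqrt zero_le_two
  have hsp : 0 < Real.sqrt ℓ := Real.sqrt_pos.mpr hℓ'
  have h2p : 0 < Real.sqrt 2 := Real.sqrt_pos.mpr two_pos
  have eK : K = g / 2 * Real.sqrt ℓ := by
    refine aux ?_ ?_
    · rw [← mul_assoc]; positivity
    · rw [mul_pow, hsq, hK2]; linarith
  have eQ : K = Q * Real.sqrt 2 := by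
    refine aux ?_ ?_
    · rw [← mul_assoc]; positivity
    · rw [mul_pow, hs2, hK2, hQ2]; ring
  refine ⟨g / 2, fun h0 => by simp [h0] at hK, fun p q => by rw [h]; ring, eK, ?_⟩
  rw [← eK, eQ, mul_div_cancel_right₀ _ h2p.ne']

end Determinants

/-! ### Effect of the affine reflections, vanishing, and passage from sines to cosines. -/

section Reflections

/-- The reflection of the first coordinate in the affine hyperplane `x = ℓ`. -/
def flipFirst {ℓ : ℕ} (a : Fin ℓ → ℝ) : Fin ℓ → ℝ :=
  fun k => if (k : ℕ) = 0 then 2 * ℓ - a k else a k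

/-- The sign change of the last coordinate. -/
def flipLast {ℓ : ℕ} (a : Fin ℓ → ℝ) : Fin ℓ → ℝ :=
  fun k => if (k : ℕ) + 1 = ℓ then -a k else a k

/-- All coordinates are integers. -/
def IsIntegral {ℓ : ℕ} (a : Fin ℓ → ℝ) : Prop := ∀ k, ∃ z : ℤ, a k = z

/-- All coordinates are halves of odd integers. -/
def IsHalfIntegral {ℓ : ℕ} (a : Fin ℓ → ℝ) : Prop := ∀ k, ∃ z : ℤ, a k = z + 1 / 2

theorem IsIntegral.flipFirst {ℓ : ℕ} {a : Fin ℓ → ℝ} (h : IsIntegral a) :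
    IsIntegral (flipFirst a) := by
  intro k
  obtain ⟨z, hz⟩ := h k
  unfold KacPetersonD.flipFirst
  split_ifs
  · exact ⟨2 * ℓ - z, by rw [hz]; push_cast; ring⟩
  · exact ⟨z, hz⟩

theorem IsIntegral.flipLast {ℓ : ℕ} {a : Fin ℓ → ℝ} (h : IsIntegral a) :
    IsIntegral (flipLast a) := by
  intro k
  obtain ⟨z, hz⟩ := h k
  unfold KacPetersonD.flipLast
  split_ifs
  · exact ⟨-z, by rw [hz]; push_cast; ring⟩
  · exact ⟨z, hz⟩

theorem IsHalfIntegral.flipFirst {ℓ : ℕ} {a : Fin ℓ → ℝ} (h : IsHalfIntegral a) :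
    IsHalfIntegral (flipFirst a) := by
  intro k
  obtain ⟨z, hz⟩ := h k
  unfold KacPetersonD.flipFirst
  split_ifs
  · exact ⟨2 * ℓ - z - 1, by rw [hz]; push_cast; ring⟩
  · exact ⟨z, hz⟩

theorem IsHalfIntegral.flipLast {ℓ : ℕ} {a : Fin ℓ → ℝ} (h : IsHalfIntegral a) :
    IsHalfIntegral (flipLast a) := by
  intro k
  obtain ⟨z, hz⟩ := h k
  unfold KacPetersonD.flipLast
  split_ifs
  · exact ⟨-z - 1, by rw [hz]; push_cast; ring⟩
  · exact ⟨z, hz⟩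

theorem isIntegral_intWeight {ℓ : ℕ} (p : Fin (ℓ + 1)) : IsIntegral (intWeight ℓ p) :=
  fun k => ⟨(ℓ : ℤ) - (p.succAbove k : ℕ), by simp [intWeight]⟩

theorem isHalfIntegral_halfWeight (ℓ : ℕ) : IsHalfIntegral (halfWeight ℓ) :=
  fun k => ⟨(ℓ : ℤ) - 1 - (k : ℕ), by simp [halfWeight]; ring⟩

theorem det_of_scaled_rows {ℓ : ℕ} (k₀ : Fin ℓ) (t : ℝ) {A B : Matrix (Fin ℓ) (Fin ℓ) ℝ}
    (h : ∀ i j, A i j = (if i = k₀ then t else 1) * B i j) : A.det = t * B.det := by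
  have : A = Matrix.of fun i j => (if i = k₀ then t else 1) * B i j := by ext i j; exact h i j
  rw [this, Matrix.det_mul_column, Finset.prod_ite_eq' Finset.univ k₀ (fun _ => t)]
  simp

theorem cosDet_flipLast {ℓ : ℕ} (a b : Fin ℓ → ℝ) : cosDet (flipLast a) b = cosDet a b := by
  unfold cosDet flipLast
  congr 1
  ext i j
  simp only [Matrix.of_apply]
  split_ifs
  · rw [neg_mul, mul_neg, neg_div, Real.cos_neg]
  · rfl

theorem sinDet_flipLast {ℓ : ℕ} (hℓ : 0 < ℓ) (a b : Fin ℓ → ℝ) :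
    sinDet (flipLast a) b = -sinDet a b := by
  rw [← neg_one_mul]
  refine det_of_scaled_rows (⟨ℓ - 1, by omega⟩ : Fin ℓ) (-1) fun i j => ?_
  simp only [Matrix.of_apply, flipLast, Fin.ext_iff]
  by_cases h : (i : ℕ) + 1 = ℓ
  · rw [if_pos h, if_pos (by omega), neg_mul, mul_neg, neg_div, Real.sin_neg]
    ring
  · rw [if_neg h, if_neg (by omega), one_mul]

theorem cosDet_flipFirst_of_isIntegral {ℓ : ℕ} (hℓ : 0 < ℓ) {a b : Fin ℓ → ℝ}
    (hb : IsIntegral b) : cosDet (flipFirst a) b = cosDet a b := by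
  unfold cosDet flipFirst
  congr 1
  ext i j
  simp only [Matrix.of_apply]
  split_ifs
  · obtain ⟨z, hz⟩ := hb j
    have : Real.pi * ((2 * ℓ - a i) * b j) / ℓ =
        z * (2 * Real.pi) - Real.pi * (a i * b j) / ℓ := by rw [hz]; field_simp
    rw [this, Real.cos_int_mul_two_pi_sub]
  · rfl

theorem sinDet_flipFirst_of_isIntegral {ℓ : ℕ} (hℓ : 0 < ℓ) {a b : Fin ℓ → ℝ}
    (hb : IsIntegral b) : sinDet (flipFirst a) b = -sinDet a b := by
  rw [← neg_one_mul]
  refine det_of_scaled_rows (⟨0, hℓ⟩ : Fin ℓ) (-1) fun i j => ?_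
  simp only [Matrix.of_apply, flipFirst, Fin.ext_iff]
  split_ifs
  · obtain ⟨z, hz⟩ := hb j
    have : Real.pi * ((2 * ℓ - a i) * b j) / ℓ =
        z * (2 * Real.pi) - Real.pi * (a i * b j) / ℓ := by rw [hz]; field_simp
    rw [this, Real.sin_int_mul_two_pi_sub]
    ring
  · rw [one_mul]

/-- For half-integral b the angle shift 2πb_j is an odd multiple of π. This extra sign interchanges
the behaviour of sine and cosine compared with integral b. -/
theorem cosDet_flipFirst_of_isHalfIntegral {ℓ : ℕ} (hℓ : 0 < ℓ) {a b : Fin ℓ → ℝ}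
    (hb : IsHalfIntegral b) : cosDet (flipFirst a) b = -cosDet a b := by
  rw [← neg_one_mul]
  refine det_of_scaled_rows (⟨0, hℓ⟩ : Fin ℓ) (-1) fun i j => ?_
  simp only [Matrix.of_apply, flipFirst, Fin.ext_iff]
  split_ifs
  · obtain ⟨z, hz⟩ := hb j
    have : Real.pi * ((2 * ℓ - a i) * b j) / ℓ =
        z * (2 * Real.pi) - Real.pi * (a i * b j) / ℓ + Real.pi := by rw [hz]; field_simp; ring
    rw [this, Real.cos_add_pi, Real.cos_int_mul_two_pi_sub]
    ring
  · rw [one_mul]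

theorem sinDet_flipFirst_of_isHalfIntegral {ℓ : ℕ} (hℓ : 0 < ℓ) {a b : Fin ℓ → ℝ}
    (hb : IsHalfIntegral b) : sinDet (flipFirst a) b = sinDet a b := by
  unfold sinDet flipFirst
  congr 1
  ext i j
  simp only [Matrix.of_apply]
  split_ifs
  · obtain ⟨z, hz⟩ := hb j
    have : Real.pi * ((2 * ℓ - a i) * b j) / ℓ =
        z * (2 * Real.pi) - Real.pi * (a i * b j) / ℓ + Real.pi := by rw [hz]; field_simp; ring
    rw [this, Real.sin_add_pi, Real.sin_int_mul_two_pi_sub, neg_neg]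
  · rfl

/-- A coordinate ℓ against half-odd integers gives angles in π/2 + πℤ, hence a zero row of cosines.
-/
theorem cosDet_eq_zero {ℓ : ℕ} (hℓ : 0 < ℓ) {a b : Fin ℓ → ℝ} (k : Fin ℓ) (hk : a k = ℓ)
    (hb : IsHalfIntegral b) : cosDet a b = 0 := by
  refine Matrix.det_eq_zero_of_row_eq_zero k fun j => ?_
  obtain ⟨z, hz⟩ := hb j
  rw [Matrix.of_apply, hk, hz]
  have : Real.pi * (ℓ * (z + 1 / 2)) / ℓ = Real.pi / 2 + z * Real.pi := by field_simp; ring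
  rw [this, Real.cos_add_int_mul_pi, Real.cos_pi_div_two]
  simp

theorem sinDet_eq_zero {ℓ : ℕ} {a : Fin ℓ → ℝ} (b : Fin ℓ → ℝ) (k : Fin ℓ) (hk : a k = 0) :
    sinDet a b = 0 := by
  refine Matrix.det_eq_zero_of_row_eq_zero k fun j => ?_
  simp [hk]

theorem sinDet_eq_zero_of_isIntegral {ℓ : ℕ} (hℓ : 0 < ℓ) {a b : Fin ℓ → ℝ} (k : Fin ℓ)
    (hk : a k = ℓ) (hb : IsIntegral b) : sinDet a b = 0 := by
  refine Matrix.det_eq_zero_of_row_eq_zero k fun j => ?_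
  obtain ⟨z, hz⟩ := hb j
  rw [Matrix.of_apply, hk, hz]
  have : Real.pi * (ℓ * (z : ℝ)) / ℓ = z * Real.pi := by field_simp
  rw [this, Real.sin_int_mul_pi, mul_zero]

theorem intWeight_first {ℓ : ℕ} (hℓ : 0 < ℓ) {p : Fin (ℓ + 1)} (hp : p ≠ 0) :
    intWeight ℓ p ⟨0, hℓ⟩ = ℓ := by
  have h : ((p.succAbove ⟨0, hℓ⟩ : Fin (ℓ + 1)) : ℕ) = 0 := by
    have : (p : ℕ) ≠ 0 := fun h => hp (Fin.ext (by simpa using h))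
    rw [Fin.succAbove_of_castSucc_lt]
    · rfl
    · exact Fin.lt_def.mpr (Nat.pos_of_ne_zero this)
  simp [intWeight, h]

theorem intWeight_last {ℓ : ℕ} (hℓ : 0 < ℓ) {p : Fin (ℓ + 1)} (hp : p ≠ Fin.last ℓ) :
    intWeight ℓ p ⟨ℓ - 1, by omega⟩ = 0 := by
  have h : ((p.succAbove ⟨ℓ - 1, by omega⟩ : Fin (ℓ + 1)) : ℕ) = ℓ := by
    have : (p : ℕ) ≠ ℓ := fun h => hp (Fin.ext h)
    rw [Fin.succAbove_of_le_castSucc]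
    · simp; omega
    · rw [Fin.le_def]; simp; omega
  simp [intWeight, h]

theorem cosDet_intWeight_halfIntegral {ℓ : ℕ} (hℓ : 0 < ℓ) {p : Fin (ℓ + 1)} (hp : p ≠ 0)
    {b : Fin ℓ → ℝ} (hb : IsHalfIntegral b) : cosDet (intWeight ℓ p) b = 0 :=
  cosDet_eq_zero hℓ _ (intWeight_first hℓ hp) hb

theorem sinDet_intWeight {ℓ : ℕ} (hℓ : 0 < ℓ) {p : Fin (ℓ + 1)} (hp : p ≠ Fin.last ℓ)
    (b : Fin ℓ → ℝ) : sinDet (intWeight ℓ p) b = 0 :=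
  sinDet_eq_zero b _ (intWeight_last hℓ hp)

/-- Only one entry is left out, so at least one of ℓ and 0 is still present, and either makes a row
of sines vanish on integers. -/
theorem sinDet_intWeight_of_isIntegral {ℓ : ℕ} (hℓ : 0 < ℓ) (p : Fin (ℓ + 1))
    {b : Fin ℓ → ℝ} (hb : IsIntegral b) : sinDet (intWeight ℓ p) b = 0 := by
  by_cases hp : p = Fin.last ℓ
  · refine sinDet_eq_zero_of_isIntegral hℓ _ (intWeight_first hℓ ?_) hb
    rw [hp]
    intro h
    have := congrArg Fin.val h
    simp at this
    omega
  · exact sinDet_intWeight hℓ hp b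

/-- Reversal inverts every pair; index i accounts for the ℓ - 1 - i pairs with a larger partner. The
product is kept in this form to cancel column signs. -/
theorem sign_revPerm (ℓ : ℕ) :
    Equiv.Perm.sign (Fin.revPerm : Equiv.Perm (Fin ℓ)) = ∏ i : Fin ℓ, (-1) ^ (ℓ - 1 - (i : ℕ)) := by
  rw [Equiv.Perm.sign_eq_prod_prod_Ioi]
  refine Finset.prod_congr rfl fun i _ => ?_
  rw [Finset.prod_congr rfl (g := fun _ => (-1 : ℤˣ)), Finset.prod_const, Fin.card_Ioi]
  intro j hj
  have : i < j := Finset.mem_Ioi.mp hj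
  simp [this.le]

/-- The substitution `a ↦ ℓ - a` turns sines into cosines. -/
theorem sinDet_halfWeight {ℓ : ℕ} (hℓ : 0 < ℓ) (a : Fin ℓ → ℝ) :
    sinDet (fun i => ℓ - a i.rev) (halfWeight ℓ) = cosDet a (halfWeight ℓ) := by
  have h : (Matrix.of fun i j : Fin ℓ => 2 * Real.sin (Real.pi * ((ℓ - a i.rev) * halfWeight ℓ j) / ℓ)) =
      Matrix.of fun i j : Fin ℓ => (-1 : ℝ) ^ (ℓ - 1 - (j : ℕ)) *
        ((Matrix.of fun i j => 2 * Real.cos (Real.pi * (a i * halfWeight ℓ j) / ℓ)).submatrix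
          (Fin.revPerm : Equiv.Perm (Fin ℓ)) id) i j := by
    ext i j
    simp only [Matrix.of_apply, Matrix.submatrix_apply, Fin.revPerm_apply, id]
    have hj : ((ℓ - 1 - (j : ℕ) : ℕ) : ℝ) = ℓ - 1 - (j : ℕ) := by
      rw [Nat.sub_sub, Nat.cast_sub (by omega)]; push_cast; ring
    -- The coordinate of `halfWeight` is (ℓ - 1 - j) + 1/2: the half turns sine into cosine and the
    -- integer leaves a sign for each column.
    have e : Real.pi * ((ℓ - a i.rev) * halfWeight ℓ j) / ℓ =
        Real.pi / 2 - Real.pi * (a i.rev * halfWeight ℓ j) / ℓ +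
          ((ℓ - 1 - (j : ℕ) : ℕ) : ℤ) * Real.pi := by
      have e1 : ((((ℓ - 1 - (j : ℕ) : ℕ) : ℤ)) : ℝ) = ℓ - 1 - (j : ℕ) := by
        rw [Int.cast_natCast, hj]
      have e2 : Real.pi * ((ℓ - a i.rev) * halfWeight ℓ j) / ℓ =
        Real.pi * halfWeight ℓ j - Real.pi * (a i.rev * halfWeight ℓ j) / ℓ := by field_simp
      rw [e1, e2]
      conv_lhs => arg 1; rw [halfWeight]
      ring
    rw [e, Real.sin_add_int_mul_pi, Real.sin_pi_div_two_sub, zpow_natCast]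
    ring
  unfold sinDet cosDet
  -- The column signs and the sign of the row reversal are the same product, so together they give
  -- 1.
  rw [h, Matrix.det_mul_row, Matrix.det_permute, sign_revPerm, ← mul_assoc]
  push_cast
  rw [← Finset.prod_mul_distrib, Finset.prod_eq_one, one_mul]
  intro i _
  rw [← mul_pow]
  simp

theorem sinDet_intWeight_last_halfWeight {ℓ : ℕ} (hℓ : 0 < ℓ) :
    sinDet (intWeight ℓ (Fin.last ℓ)) (halfWeight ℓ) = cosDet (intWeight ℓ 0) (halfWeight ℓ) := by
  rw [← sinDet_halfWeight hℓ]
  congr 1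
  ext i
  rw [intWeight_zero]
  simp [intWeight, intSeq]

/-- The half-integral sequence is invariant under a ↦ ℓ - a followed by reversal. -/
theorem sinDet_halfWeight_halfWeight {ℓ : ℕ} (hℓ : 0 < ℓ) :
    sinDet (halfWeight ℓ) (halfWeight ℓ) = cosDet (halfWeight ℓ) (halfWeight ℓ) := by
  rw [← sinDet_halfWeight hℓ]
  congr 1
  ext i
  have : (i : ℕ) + 1 ≤ ℓ := i.isLt
  simp only [halfWeight, Fin.val_rev]
  rw [Nat.cast_sub this]
  push_cast
  ring

end Reflections

/-! ### The labels in coordinates, and their determinants. -/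

section LabelWeights

theorem fundWeight_of_add_two_le {ℓ j : ℕ} (h : j + 2 ≤ ℓ) (i : Fin ℓ) :
    fundWeight ℓ j i = if (i : ℕ) + 1 ≤ j then 1 else 0 := by
  rw [fundWeight, if_pos h]

theorem fundWeight_pred {ℓ : ℕ} (h : 1 ≤ ℓ) (i : Fin ℓ) :
    fundWeight ℓ (ℓ - 1) i = if (i : ℕ) + 1 = ℓ then -(1 / 2) else 1 / 2 := by
  rw [fundWeight, if_neg (by omega), if_pos (by omega)]

theorem fundWeight_self {ℓ : ℕ} (i : Fin ℓ) : fundWeight ℓ ℓ i = 1 / 2 := by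
  rw [fundWeight, if_neg (by omega), if_neg (by omega)]

theorem rhoBar_apply {ℓ : ℕ} (hℓ : 2 ≤ ℓ) (i : Fin ℓ) : rhoBar ℓ i = ℓ - 1 - ((i : ℕ) : ℝ) := by
  obtain ⟨n, rfl⟩ : ∃ n, ℓ = n + 2 := ⟨ℓ - 2, by omega⟩
  have hsum : ∑ j ∈ Finset.Icc 1 n, fundWeight (n + 2) j i = ((n - (i : ℕ) : ℕ) : ℝ) := by
    have : ∀ j ∈ Finset.Icc 1 n, fundWeight (n + 2) j i = if (i : ℕ) + 1 ≤ j then 1 else 0 :=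
      fun j hj => fundWeight_of_add_two_le (by have := (Finset.mem_Icc.mp hj).2; omega) i
    rw [Finset.sum_congr rfl this, Finset.sum_boole]
    congr 1
    have : (Finset.Icc 1 n).filter (fun j => (i : ℕ) + 1 ≤ j) = Finset.Icc ((i : ℕ) + 1) n := by
      ext j; simp only [Finset.mem_filter, Finset.mem_Icc]; omega
    rw [this, Nat.card_Icc]
    omega
  have h1 := fundWeight_pred (ℓ := n + 2) (by omega) i
  rw [rhoBar, Finset.sum_apply, Finset.sum_Icc_succ_top (by omega),
    Finset.sum_Icc_succ_top (by omega), hsum, fundWeight_self,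
    show n + 1 = n + 2 - 1 by omega, h1]
  have hi := i.isLt
  by_cases h : (i : ℕ) + 1 = n + 2
  · have h' : (i : ℕ) = n + 1 := by omega
    rw [if_pos h, h', show n - (n + 1) = 0 by omega]
    push_cast
    ring
  · rw [if_neg h, Nat.cast_sub (by omega)]
    push_cast
    ring

theorem labelWeight_inl_zero {ℓ : ℕ} (hℓ : 3 ≤ ℓ) :
    labelWeight ℓ (.inl 0) = intWeight ℓ 0 := by
  ext k
  simp [labelWeight, intWeight, rhoBar_apply (show 2 ≤ ℓ by omega)]
  ring

/-- Adding 2Λ̄_1 moves the first coordinate from ℓ - 1 to ℓ + 1 = 2ℓ - (ℓ - 1). -/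
theorem labelWeight_inl_one {ℓ : ℕ} (hℓ : 3 ≤ ℓ) :
    labelWeight ℓ (.inl 1) = flipFirst (intWeight ℓ 0) := by
  ext k
  simp only [labelWeight, Matrix.cons_val_one, Matrix.cons_val_zero, Pi.add_apply, Pi.smul_apply,
    rhoBar_apply (show 2 ≤ ℓ by omega), fundWeight_of_add_two_le (show 1 + 2 ≤ ℓ by omega),
    flipFirst, intWeight, Fin.zero_succAbove, Fin.val_succ, smul_eq_mul]
  by_cases h : (k : ℕ) = 0
  · rw [if_pos (by omega), if_pos h, h]; push_cast; ring
  · rw [if_neg (by omega), if_neg h]; push_cast; ring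

theorem labelWeight_inl_two {ℓ : ℕ} (hℓ : 3 ≤ ℓ) :
    labelWeight ℓ (.inl 2) = flipLast (intWeight ℓ (Fin.last ℓ)) := by
  ext k
  simp only [labelWeight, Matrix.cons_val, Pi.add_apply, Pi.smul_apply,
    rhoBar_apply (show 2 ≤ ℓ by omega), fundWeight_pred (show 1 ≤ ℓ by omega),
    flipLast, intWeight, Fin.succAbove_last, Fin.val_castSucc, smul_eq_mul]
  by_cases h : (k : ℕ) + 1 = ℓ
  · have : ((k : ℕ) : ℝ) = ℓ - 1 := by rw [eq_sub_iff_add_eq]; exact_mod_cast h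
    rw [if_pos h, if_pos h, this]; ring
  · rw [if_neg h, if_neg h]; ring

theorem labelWeight_inl_three {ℓ : ℕ} (hℓ : 3 ≤ ℓ) :
    labelWeight ℓ (.inl 3) = intWeight ℓ (Fin.last ℓ) := by
  ext k
  simp only [labelWeight, Matrix.cons_val, Pi.add_apply, Pi.smul_apply,
    rhoBar_apply (show 2 ≤ ℓ by omega), fundWeight_self,
    intWeight, Fin.succAbove_last, Fin.val_castSucc, smul_eq_mul]
  ring

/-- The position of the entry that is left out of the weight `ν_{i+1}`. -/
def midIndex {ℓ : ℕ} (i : Fin (ℓ - 1)) : Fin (ℓ + 1) := ⟨(i : ℕ) + 1, by omega⟩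

/-- The sum Λ̄_{ℓ-1} + Λ̄_ℓ is (1, …, 1, 0), so ν_{ℓ-1} continues the pattern of the other ν_i:
raising the first i entries of ρ̄ by 1 opens the gap at ℓ - i. -/
theorem labelWeight_mid {ℓ : ℕ} (hℓ : 3 ≤ ℓ) (i : Fin (ℓ - 1)) :
    labelWeight ℓ (.inr (.inl i)) = intWeight ℓ (midIndex i) := by
  ext k
  have hk := k.isLt
  have hi := i.isLt
  have hR : intWeight ℓ (midIndex i) k =
      ℓ - 1 - ((k : ℕ) : ℝ) + if (k : ℕ) < (i : ℕ) + 1 then 1 else 0 := by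
    simp only [intWeight, midIndex, Fin.succAbove, Fin.lt_def, Fin.val_castSucc]
    split_ifs
    · rw [Fin.val_castSucc]; ring
    · simp only [Fin.val_succ]; push_cast; ring
  rw [hR]
  simp only [labelWeight, Pi.add_apply, rhoBar_apply (show 2 ≤ ℓ by omega)]
  congr 1
  split_ifs with h1 h2 h2
  · rw [Pi.add_apply, fundWeight_pred (by omega), fundWeight_self, if_neg (by omega)]; norm_num
  · rw [Pi.add_apply, fundWeight_pred (by omega), fundWeight_self, if_pos (by omega)]; norm_num
  · rw [fundWeight_of_add_two_le (by omega), if_pos (by omega)]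
  · rw [fundWeight_of_add_two_le (by omega), if_neg (by omega)]

theorem labelWeight_mu_zero {ℓ : ℕ} (hℓ : 3 ≤ ℓ) :
    labelWeight ℓ (.inr (.inr 0)) = halfWeight ℓ := by
  ext k
  simp only [labelWeight, Matrix.cons_val, Pi.add_apply,
    rhoBar_apply (show 2 ≤ ℓ by omega), fundWeight_self, halfWeight]
  ring

theorem labelWeight_mu_one {ℓ : ℕ} (hℓ : 3 ≤ ℓ) :
    labelWeight ℓ (.inr (.inr 1)) = flipLast (halfWeight ℓ) := by
  ext k
  simp only [labelWeight, Matrix.cons_val, Pi.add_apply,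
    rhoBar_apply (show 2 ≤ ℓ by omega), fundWeight_pred (show 1 ≤ ℓ by omega), flipLast,
    halfWeight]
  by_cases h : (k : ℕ) + 1 = ℓ
  · have : ((k : ℕ) : ℝ) = ℓ - 1 := by rw [eq_sub_iff_add_eq]; exact_mod_cast h
    rw [if_pos h, if_pos h, this]; ring
  · rw [if_neg h, if_neg h]; ring

theorem labelWeight_mu_two {ℓ : ℕ} (hℓ : 3 ≤ ℓ) :
    labelWeight ℓ (.inr (.inr 2)) = flipFirst (halfWeight ℓ) := by
  ext k
  simp only [labelWeight, Matrix.cons_val, Pi.add_apply,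
    rhoBar_apply (show 2 ≤ ℓ by omega), fundWeight_of_add_two_le (show 1 + 2 ≤ ℓ by omega),
    fundWeight_self, flipFirst, halfWeight]
  by_cases h : (k : ℕ) = 0
  · rw [if_pos (by omega), if_pos h, h]; push_cast; ring
  · rw [if_neg (by omega), if_neg h]; ring

theorem labelWeight_mu_three {ℓ : ℕ} (hℓ : 3 ≤ ℓ) :
    labelWeight ℓ (.inr (.inr 3)) = flipFirst (flipLast (halfWeight ℓ)) := by
  ext k
  simp only [labelWeight, Matrix.cons_val, Pi.add_apply,
    rhoBar_apply (show 2 ≤ ℓ by omega), fundWeight_of_add_two_le (show 1 + 2 ≤ ℓ by omega),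
    fundWeight_pred (show 1 ≤ ℓ by omega), flipFirst, flipLast, halfWeight]
  by_cases h : (k : ℕ) = 0
  · rw [if_pos (by omega), if_pos h, if_neg (by omega), if_neg (by omega), h]; push_cast; ring
  · rw [if_neg (by omega), if_neg h]
    by_cases h' : (k : ℕ) + 1 = ℓ
    · have : ((k : ℕ) : ℝ) = ℓ - 1 := by rw [eq_sub_iff_add_eq]; exact_mod_cast h'
      rw [if_pos h', if_pos h', this]; ring
    · rw [if_neg h', if_neg h']; ring

/-- The position of the entry that is left out of the weights of the first four labels. -/
def endIndex (ℓ : ℕ) : Fin 4 → Fin (ℓ + 1) := ![0, 0, Fin.last ℓ, Fin.last ℓ]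

/-- The signs of the first coordinate reflection in the weights of the last four labels. -/
def signFirst : Fin 4 → ℝ := ![1, 1, -1, -1]

/-- The signs of the last coordinate in the weights of the last four labels. -/
def signLast : Fin 4 → ℝ := ![1, -1, 1, -1]

theorem isIntegral_labelWeight_inl {ℓ : ℕ} (hℓ : 3 ≤ ℓ) (a : Fin 4) :
    IsIntegral (labelWeight ℓ (.inl a)) := by
  fin_cases a
  · exact (labelWeight_inl_zero hℓ).symm ▸ isIntegral_intWeight 0
  · exact (labelWeight_inl_one hℓ).symm ▸ (isIntegral_intWeight 0).flipFirst
  · exact (labelWeight_inl_two hℓ).symm ▸ (isIntegral_intWeight _).flipLast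
  · exact (labelWeight_inl_three hℓ).symm ▸ isIntegral_intWeight _

theorem isHalfIntegral_labelWeight_mu {ℓ : ℕ} (hℓ : 3 ≤ ℓ) (b : Fin 4) :
    IsHalfIntegral (labelWeight ℓ (.inr (.inr b))) := by
  fin_cases b
  · exact (labelWeight_mu_zero hℓ).symm ▸ isHalfIntegral_halfWeight ℓ
  · exact (labelWeight_mu_one hℓ).symm ▸ (isHalfIntegral_halfWeight ℓ).flipLast
  · exact (labelWeight_mu_two hℓ).symm ▸ (isHalfIntegral_halfWeight ℓ).flipFirst
  · exact (labelWeight_mu_three hℓ).symm ▸ (isHalfIntegral_halfWeight ℓ).flipLast.flipFirst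

theorem cosDet_labelWeight_inl_of_isIntegral {ℓ : ℕ} (hℓ : 3 ≤ ℓ) (a : Fin 4) {b : Fin ℓ → ℝ}
    (hb : IsIntegral b) :
    cosDet (labelWeight ℓ (.inl a)) b = cosDet (intWeight ℓ (endIndex ℓ a)) b := by
  fin_cases a
  · exact congrArg (cosDet · b) (labelWeight_inl_zero hℓ)
  · exact (congrArg (cosDet · b) (labelWeight_inl_one hℓ)).trans
      (cosDet_flipFirst_of_isIntegral (by omega) hb)
  · exact (congrArg (cosDet · b) (labelWeight_inl_two hℓ)).trans (cosDet_flipLast _ _)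
  · exact congrArg (cosDet · b) (labelWeight_inl_three hℓ)

theorem sinDet_labelWeight_inl_of_isIntegral {ℓ : ℕ} (hℓ : 3 ≤ ℓ) (a : Fin 4) {b : Fin ℓ → ℝ}
    (hb : IsIntegral b) : sinDet (labelWeight ℓ (.inl a)) b = 0 := by
  have h := fun p => sinDet_intWeight_of_isIntegral (show 0 < ℓ by omega) p hb
  fin_cases a
  · exact (congrArg (sinDet · b) (labelWeight_inl_zero hℓ)).trans (h _)
  · refine (congrArg (sinDet · b) (labelWeight_inl_one hℓ)).trans ?_
    rw [sinDet_flipFirst_of_isIntegral (by omega) hb, h, neg_zero]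
  · refine (congrArg (sinDet · b) (labelWeight_inl_two hℓ)).trans ?_
    rw [sinDet_flipLast (by omega), h, neg_zero]
  · exact (congrArg (sinDet · b) (labelWeight_inl_three hℓ)).trans (h _)

theorem cosDet_labelWeight_inl_of_isHalfIntegral {ℓ : ℕ} (hℓ : 3 ≤ ℓ) (a : Fin 4)
    {b : Fin ℓ → ℝ} (hb : IsHalfIntegral b) :
    cosDet (labelWeight ℓ (.inl a)) b =
      (![1, -1, 0, 0] : Fin 4 → ℝ) a * cosDet (intWeight ℓ 0) b := by
  have hlast : Fin.last ℓ ≠ 0 := fun h => by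
    have := congrArg Fin.val h
    simp at this
    omega
  have h := cosDet_intWeight_halfIntegral (show 0 < ℓ by omega) hlast hb
  fin_cases a
  · refine (congrArg (cosDet · b) (labelWeight_inl_zero hℓ)).trans ?_
    simp
  · refine (congrArg (cosDet · b) (labelWeight_inl_one hℓ)).trans ?_
    rw [cosDet_flipFirst_of_isHalfIntegral (by omega) hb]
    simp
  · refine (congrArg (cosDet · b) (labelWeight_inl_two hℓ)).trans ?_
    rw [cosDet_flipLast, h]
    simp
  · refine (congrArg (cosDet · b) (labelWeight_inl_three hℓ)).trans ?_
    rw [h]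
    simp

theorem sinDet_labelWeight_inl {ℓ : ℕ} (hℓ : 3 ≤ ℓ) (a : Fin 4)
    {b : Fin ℓ → ℝ} (hb : IsHalfIntegral b) : sinDet (labelWeight ℓ (.inl a)) b =
      (![0, 0, -1, 1] : Fin 4 → ℝ) a * sinDet (intWeight ℓ (Fin.last ℓ)) b := by
  have hlast : 0 ≠ Fin.last ℓ := fun h => by
    have := congrArg Fin.val h
    simp at this
    omega
  have h := sinDet_intWeight (show 0 < ℓ by omega) hlast b
  fin_cases a
  · refine (congrArg (sinDet · b) (labelWeight_inl_zero hℓ)).trans ?_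
    rw [h]
    simp
  · refine (congrArg (sinDet · b) (labelWeight_inl_one hℓ)).trans ?_
    rw [sinDet_flipFirst_of_isHalfIntegral (by omega) hb, h]
    simp
  · refine (congrArg (sinDet · b) (labelWeight_inl_two hℓ)).trans ?_
    rw [sinDet_flipLast (by omega)]
    simp
  · refine (congrArg (sinDet · b) (labelWeight_inl_three hℓ)).trans ?_
    simp

theorem cosDet_labelWeight_mu_of_isIntegral {ℓ : ℕ} (hℓ : 3 ≤ ℓ) (c : Fin 4) {b : Fin ℓ → ℝ}
    (hb : IsIntegral b) :
    cosDet (labelWeight ℓ (.inr (.inr c))) b = cosDet (halfWeight ℓ) b := by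
  fin_cases c
  · exact congrArg (cosDet · b) (labelWeight_mu_zero hℓ)
  · exact (congrArg (cosDet · b) (labelWeight_mu_one hℓ)).trans (cosDet_flipLast _ _)
  · exact (congrArg (cosDet · b) (labelWeight_mu_two hℓ)).trans
      (cosDet_flipFirst_of_isIntegral (by omega) hb)
  · refine (congrArg (cosDet · b) (labelWeight_mu_three hℓ)).trans ?_
    rw [cosDet_flipFirst_of_isIntegral (by omega) hb, cosDet_flipLast]

theorem sinDet_labelWeight_mu_of_isIntegral {ℓ : ℕ} (hℓ : 3 ≤ ℓ) (c : Fin 4) {b : Fin ℓ → ℝ}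
    (hb : IsIntegral b) : sinDet (labelWeight ℓ (.inr (.inr c))) b =
      signFirst c * signLast c * sinDet (halfWeight ℓ) b := by
  fin_cases c
  · refine (congrArg (sinDet · b) (labelWeight_mu_zero hℓ)).trans ?_
    simp [signFirst, signLast]
  · refine (congrArg (sinDet · b) (labelWeight_mu_one hℓ)).trans ?_
    rw [sinDet_flipLast (by omega)]
    simp [signFirst, signLast]
  · refine (congrArg (sinDet · b) (labelWeight_mu_two hℓ)).trans ?_
    rw [sinDet_flipFirst_of_isIntegral (by omega) hb]
    simp [signFirst, signLast]
  · refine (congrArg (sinDet · b) (labelWeight_mu_three hℓ)).trans ?_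
    rw [sinDet_flipFirst_of_isIntegral (by omega) hb, sinDet_flipLast (by omega)]
    simp [signFirst, signLast]

theorem cosDet_labelWeight_mu_of_isHalfIntegral {ℓ : ℕ} (hℓ : 3 ≤ ℓ) (c : Fin 4)
    {b : Fin ℓ → ℝ} (hb : IsHalfIntegral b) :
    cosDet (labelWeight ℓ (.inr (.inr c))) b = signFirst c * cosDet (halfWeight ℓ) b := by
  fin_cases c
  · refine (congrArg (cosDet · b) (labelWeight_mu_zero hℓ)).trans ?_
    simp [signFirst]
  · refine (congrArg (cosDet · b) (labelWeight_mu_one hℓ)).trans ?_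
    rw [cosDet_flipLast]
    simp [signFirst]
  · refine (congrArg (cosDet · b) (labelWeight_mu_two hℓ)).trans ?_
    rw [cosDet_flipFirst_of_isHalfIntegral (by omega) hb]
    simp [signFirst]
  · refine (congrArg (cosDet · b) (labelWeight_mu_three hℓ)).trans ?_
    rw [cosDet_flipFirst_of_isHalfIntegral (by omega) hb, cosDet_flipLast]
    simp [signFirst]

theorem sinDet_labelWeight_mu_of_isHalfIntegral {ℓ : ℕ} (hℓ : 3 ≤ ℓ) (c : Fin 4)
    {b : Fin ℓ → ℝ} (hb : IsHalfIntegral b) :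
    sinDet (labelWeight ℓ (.inr (.inr c))) b = signLast c * sinDet (halfWeight ℓ) b := by
  fin_cases c
  · refine (congrArg (sinDet · b) (labelWeight_mu_zero hℓ)).trans ?_
    simp [signLast]
  · refine (congrArg (sinDet · b) (labelWeight_mu_one hℓ)).trans ?_
    rw [sinDet_flipLast (by omega)]
    simp [signLast]
  · refine (congrArg (sinDet · b) (labelWeight_mu_two hℓ)).trans ?_
    rw [sinDet_flipFirst_of_isHalfIntegral (by omega) hb]
    simp [signLast]
  · refine (congrArg (sinDet · b) (labelWeight_mu_three hℓ)).trans ?_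
    rw [sinDet_flipFirst_of_isHalfIntegral (by omega) hb, sinDet_flipLast (by omega)]
    simp [signLast]

end LabelWeights

/-! ### The Weyl sums of all labels form a multiple of the rescaled table. -/

section WeylSums

theorem signedI_eq (ℓ : ℕ) : signedI ℓ = (-Complex.I) ^ ℓ := by
  unfold signedI
  split_ifs with h
  · exact (h.neg_pow _).symm
  · exact ((Nat.not_even_iff_odd.mp h).neg_pow _).symm

theorem rt_mul_self (n : ℕ) : rt n * rt n = n := by
  unfold rt
  rw [← Complex.ofReal_mul, Real.mul_self_sqrt (Nat.cast_nonneg n), Complex.ofReal_natCast]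

theorem rt_ne_zero {n : ℕ} (hn : 0 < n) : rt n ≠ 0 := by
  intro h
  have := rt_mul_self n
  rw [h, mul_zero] at this
  exact hn.ne' (by exact_mod_cast this.symm)

theorem zeta8_eq : zeta8 = (1 + Complex.I) / rt 2 := by
  have h : 2 * (Real.pi : ℂ) * Complex.I / 8 = ((Real.pi / 4 : ℝ) : ℂ) * Complex.I := by
    push_cast; ring
  have h2 : rt 2 ≠ 0 := rt_ne_zero two_pos
  have h3 : rt 2 = ((Real.sqrt 2 : ℝ) : ℂ) := by simp [rt]
  rw [zeta8, h, Complex.exp_mul_I, ← Complex.ofReal_cos, ← Complex.ofReal_sin,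
    Real.cos_pi_div_four, Real.sin_pi_div_four, eq_div_iff h2]
  push_cast
  rw [← h3]
  linear_combination (1 + Complex.I) / 2 * rt_mul_self 2

theorem zeta8_sq : zeta8 ^ 2 = Complex.I := by
  have h2 : rt 2 ≠ 0 := rt_ne_zero two_pos
  rw [zeta8_eq, div_pow, div_eq_iff (pow_ne_zero 2 h2)]
  linear_combination Complex.I_sq - Complex.I * rt_mul_self 2

theorem zeta8_pow_eight : zeta8 ^ 8 = 1 := by
  rw [show 8 = 2 * 4 from rfl, pow_mul, zeta8_sq, Complex.I_pow_four]

/-- One formula covers the four shapes of the block: they are the four values of ε = (-i)^ℓ, with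
the cosine part carrying `signFirst` and the sine part `signLast`. -/
theorem blockW_eq (ℓ : ℕ) (a b : Fin 4) :
    blockW ℓ a b = ((signFirst a : ℂ) * signFirst b + signedI ℓ * (signLast a * signLast b)) / rt 2 := by
  have h2 : rt 2 ≠ 0 := rt_ne_zero two_pos
  have hrr : rt 2 * rt 2 = 2 := by simpa using rt_mul_self 2
  have hmod : ∀ k, zeta8 ^ k = zeta8 ^ (k % 8) := fun k => pow_eq_pow_mod k zeta8_pow_eight
  have z3 : zeta8 ^ 3 = (-1 + Complex.I) / rt 2 := by
    rw [pow_succ, zeta8_sq, zeta8_eq]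
    field_simp
    linear_combination Complex.I_sq
  have z5 : zeta8 ^ 5 = (-1 - Complex.I) / rt 2 := by
    rw [show 5 = 3 + 2 from rfl, pow_add, z3, zeta8_sq]
    field_simp
    linear_combination Complex.I_sq
  have z7 : zeta8 ^ 7 = (1 - Complex.I) / rt 2 := by
    rw [show 7 = 5 + 2 from rfl, pow_add, z5, zeta8_sq]
    field_simp
    linear_combination -Complex.I_sq
  have hinv : ∀ k, (zeta8 ^ k)⁻¹ = zeta8 ^ (7 * k % 8) := by
    intro k
    rw [← hmod]
    refine inv_eq_of_mul_eq_one_right ?_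
    rw [← pow_add, show k + 7 * k = 8 * k by ring, pow_mul, zeta8_pow_eight, one_pow]
  have hε : signedI ℓ = (-Complex.I) ^ (ℓ % 4) := by
    rw [signedI_eq]
    exact pow_eq_pow_mod ℓ (by rw [neg_pow, Complex.I_pow_four]; norm_num)
  have hlt : ℓ % 4 < 4 := Nat.mod_lt _ (by norm_num)
  unfold blockW
  generalize ℓ % 4 = r at hε hlt
  rw [hε]
  have h3 : (-Complex.I) ^ 3 = Complex.I := by
    linear_combination -Complex.I * Complex.I_sq
  have h2' : (-Complex.I) ^ 2 = -1 := by rw [neg_sq, Complex.I_sq]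
  interval_cases r
  · simp only [if_neg (show ¬ (0 = 1) by decide), if_neg (show ¬ (0 = 3) by decide),
      if_neg (show ¬ (0 = 2) by decide)]
    fin_cases a <;> fin_cases b <;> simp [signFirst, signLast] <;> field_simp <;>
      first | linear_combination hrr | linear_combination -hrr
  · simp only [if_true, Matrix.of_apply, hinv]
    fin_cases a <;> fin_cases b <;> simp [signFirst, signLast, z3, z5, z7] <;>
      (try rw [zeta8_eq]) <;> ring
  · simp only [if_neg (show ¬ (2 = 1) by decide), if_neg (show ¬ (2 = 3) by decide),
      if_true, h2']
    fin_cases a <;> fin_cases b <;> simp [signFirst, signLast] <;> field_simp <;>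
      first | linear_combination hrr | linear_combination -hrr
  · simp only [if_neg (show ¬ (3 = 1) by decide), if_true, Matrix.of_apply, h3]
    rw [hmod]
    fin_cases a <;> fin_cases b <;> simp [signFirst, signLast, z3, z5, z7] <;>
      (try rw [zeta8_eq]) <;> ring

/-- The row factors by which the Kac-Peterson matrix differs from the table. -/
def rowScale (ℓ : ℕ) : Label ℓ → ℂ
  | .inl _ => 1
  | .inr (.inl _) => 2
  | .inr (.inr _) => rt ℓ

theorem cosTwo_eq (ℓ j : ℕ) : cosTwo ℓ j = 2 * ((Real.cos (Real.pi * j / ℓ) : ℝ) : ℂ) := by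
  have : 2 * Real.pi * (j : ℝ) / (2 * (ℓ : ℝ)) = Real.pi * j / ℓ := by
    rw [mul_assoc, mul_div_mul_left _ _ two_ne_zero]
  rw [cosTwo, this]
  push_cast
  ring

theorem exists_weylSum_labelWeight {ℓ : ℕ} (hℓ : 3 ≤ ℓ) : ∃ m : ℝ, m ≠ 0 ∧ ∀ x y,
    weylSum ℓ 2 (labelWeight ℓ x) (labelWeight ℓ y) =
      (m : ℂ) * (rowScale ℓ x * table ℓ x y) := by
  have hℓ0 : 0 < ℓ := by omega
  have hℓ' : (ℓ : ℝ) ≠ 0 := by positivity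
  obtain ⟨m, hm, hI, hK, hQ⟩ := exists_cosDet_scale hℓ0
  -- The 1/2 is the one in `weylSum_eq`.
  refine ⟨m / 2, by positivity, ?_⟩
  have hcomm : ∀ a b : Fin ℓ → ℝ, weylSum ℓ 2 a b = weylSum ℓ 2 b a := by
    intro a b
    rw [weylSum_eq, weylSum_eq, cosDet_comm, sinDet_comm]
  have hrt : rt ℓ = ((Real.sqrt ℓ : ℝ) : ℂ) := rfl
  have hint := isIntegral_labelWeight_inl hℓ
  have hmid : ∀ i, IsIntegral (labelWeight ℓ (.inr (.inl i))) := fun i =>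
    (labelWeight_mid hℓ i).symm ▸ isIntegral_intWeight _
  have hhalf := isHalfIntegral_labelWeight_mu hℓ
  have hmid0 : ∀ i : Fin (ℓ - 1), midIndex i ≠ 0 := fun i h => by
    have := congrArg Fin.val h
    simp [midIndex] at this
  have hmidl : ∀ i : Fin (ℓ - 1), midIndex i ≠ Fin.last ℓ := fun i h => by
    have h1 := congrArg Fin.val h
    have := i.isLt
    simp [midIndex] at h1
    omega
  have wmid : ∀ i : Fin (ℓ - 1), trapWeight ℓ ((midIndex i : Fin (ℓ + 1)) : ℕ) = 1 := fun i => by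
    have := i.isLt
    rw [trapWeight, if_neg]
    simp only [midIndex]
    omega
  have wend : ∀ a, trapWeight ℓ (endIndex ℓ a : ℕ) = 1 / 2 := fun a => by
    fin_cases a <;> simp [endIndex, trapWeight]
  have hcosπ : ∀ j : ℕ, Real.cos (Real.pi * ((ℓ : ℝ) * j) / ℓ) = (-1) ^ j := fun j => by
    have : Real.pi * ((ℓ : ℝ) * j) / ℓ = j * Real.pi := by field_simp
    rw [this, Real.cos_nat_mul_pi]
  have emid : ∀ (a : Fin 4) (j : Fin (ℓ - 1)),
      weylSum ℓ 2 (labelWeight ℓ (.inl a)) (labelWeight ℓ (.inr (.inl j))) =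
      (m / 2 : ℂ) * (![2, 2, 2 * (-1) ^ ((j : ℕ) + 1), 2 * (-1) ^ ((j : ℕ) + 1)] :
        Fin 4 → ℂ) a := by
    intro a j
    rw [weylSum_eq, cosDet_labelWeight_inl_of_isIntegral hℓ a (hmid j),
      sinDet_labelWeight_inl_of_isIntegral hℓ a (hmid j), labelWeight_mid hℓ, hI, wmid, wend]
    have h1 := hcosπ ((j : ℕ) + 1)
    push_cast at h1
    fin_cases a <;> simp [endIndex, midIndex, -Complex.ofReal_cos, h1] <;> ring
  have ehalf : ∀ a b : Fin 4,
      weylSum ℓ 2 (labelWeight ℓ (.inl a)) (labelWeight ℓ (.inr (.inr b))) =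
      (m / 2 : ℂ) * (rt ℓ * ((![1, -1, 0, 0] : Fin 4 → ℂ) a + signedI ℓ *
        ((![0, 0, -1, 1] : Fin 4 → ℂ) a * (signFirst b * signLast b)))) := by
    intro a b
    rw [weylSum_eq, cosDet_labelWeight_inl_of_isHalfIntegral hℓ a (hhalf b),
      sinDet_labelWeight_inl hℓ a (hhalf b), cosDet_comm,
      cosDet_labelWeight_mu_of_isIntegral hℓ b (isIntegral_intWeight _), sinDet_comm,
      sinDet_labelWeight_mu_of_isIntegral hℓ b (isIntegral_intWeight _), cosDet_comm, hK,
      sinDet_comm, sinDet_intWeight_last_halfWeight hℓ0, hK, ← signedI_eq, hrt]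
    fin_cases a <;> simp <;> ring
  have emh : ∀ (i : Fin (ℓ - 1)) (b : Fin 4),
      weylSum ℓ 2 (labelWeight ℓ (.inr (.inl i))) (labelWeight ℓ (.inr (.inr b))) = 0 := by
    intro i b
    rw [weylSum_eq, labelWeight_mid hℓ, cosDet_intWeight_halfIntegral hℓ0 (hmid0 i) (hhalf b),
      sinDet_intWeight hℓ0 (hmidl i)]
    simp
  rintro (a | i | a) (b | j | b)
  · rw [weylSum_eq, cosDet_labelWeight_inl_of_isIntegral hℓ a (hint b), cosDet_comm,
      cosDet_labelWeight_inl_of_isIntegral hℓ b (isIntegral_intWeight _),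
      sinDet_labelWeight_inl_of_isIntegral hℓ a (hint b), hI, wend, wend]
    fin_cases a <;> fin_cases b <;>
      simp [endIndex, rowScale, table, -Complex.ofReal_cos, hcosπ] <;> ring
  · rw [emid]
    simp [rowScale, table]
  · rw [ehalf]
    fin_cases a <;> fin_cases b <;> simp [rowScale, table, signFirst, signLast]
  · rw [hcomm, emid]
    fin_cases b <;> simp [rowScale, table]
  · rw [weylSum_eq, labelWeight_mid hℓ, labelWeight_mid hℓ,
      sinDet_intWeight_of_isIntegral hℓ0 _ (isIntegral_intWeight _), hI, wmid, wmid]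
    simp [rowScale, table, midIndex, cosTwo_eq]
    ring
  · rw [emh]
    simp [rowScale, table]
  · rw [hcomm, ehalf]
    fin_cases a <;> fin_cases b <;> simp [rowScale, table, signFirst, signLast]
  · rw [hcomm, emh]
    simp [rowScale, table]
  · rw [weylSum_eq, cosDet_labelWeight_mu_of_isHalfIntegral hℓ a (hhalf b),
      sinDet_labelWeight_mu_of_isHalfIntegral hℓ a (hhalf b), cosDet_comm,
      cosDet_labelWeight_mu_of_isHalfIntegral hℓ b (isHalfIntegral_halfWeight ℓ), sinDet_comm,
      sinDet_labelWeight_mu_of_isHalfIntegral hℓ b (isHalfIntegral_halfWeight ℓ),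
      sinDet_halfWeight_halfWeight hℓ0, hQ, ← signedI_eq]
    simp only [rowScale, table, Matrix.of_apply, blockW_eq]
    have h2 : rt 2 = ((Real.sqrt 2 : ℝ) : ℂ) := by simp [rt]
    rw [hrt, h2]
    push_cast
    ring

end WeylSums

/-! ### Orthogonality of the columns of the rescaled table. -/

section Unitarity

/-- The middle rows are the inner nodes of the type I transform; the subtracted terms are its nodes
0 and ℓ, each of weight 1/2. -/
theorem sum_mid_cos_mul_cos {ℓ a b : ℕ} (hℓ : 2 ≤ ℓ) (ha : a ≤ ℓ) (hb : b ≤ ℓ) :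
    ∑ i : Fin (ℓ - 1), 2 * Real.cos (Real.pi * (a * ((i : ℕ) + 1 : ℕ)) / ℓ) *
      (2 * Real.cos (Real.pi * (((i : ℕ) + 1 : ℕ) * b) / ℓ)) =
      (if a = b then 2 * ℓ / trapWeight ℓ a else 0) - 2 - 2 * ((-1) ^ a * (-1) ^ b) := by
  have h := sum_trapWeight_cos_mul_cos (n := ℓ) (by omega) ha hb
  rw [← h]
  obtain ⟨n, rfl⟩ : ∃ n, ℓ = n + 1 := ⟨ℓ - 1, by omega⟩
  have hne : ((n + 1 : ℕ) : ℝ) ≠ 0 := by positivity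
  have e1 : Real.pi * (a * ((n + 1 : ℕ) : ℝ)) / ((n + 1 : ℕ) : ℝ) = a * Real.pi := by
    field_simp
  have e2 : Real.pi * (((n + 1 : ℕ) : ℝ) * b) / ((n + 1 : ℕ) : ℝ) = b * Real.pi := by
    field_simp
  rw [Finset.sum_range_succ, Finset.sum_range_succ', e1, e2, Real.cos_nat_mul_pi,
    Real.cos_nat_mul_pi, Finset.sum_range]
  have e3 : ∀ i : Fin n, trapWeight (n + 1) ((i : ℕ) + 1) = 1 := by
    intro i
    have := i.isLt
    rw [trapWeight, if_neg (by omega)]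
  simp only [e3, one_mul]
  simp [trapWeight]
  ring

theorem sum_mid_cosTwo {ℓ : ℕ} (hℓ : 2 ≤ ℓ) (j k : Fin (ℓ - 1)) :
    ∑ i : Fin (ℓ - 1), cosTwo ℓ (((i : ℕ) + 1) * ((j : ℕ) + 1)) *
      cosTwo ℓ (((i : ℕ) + 1) * ((k : ℕ) + 1)) =
      (if j = k then 2 * (ℓ : ℂ) else 0) - 2 - 2 * ((-1) ^ ((j : ℕ) + 1) * (-1) ^ ((k : ℕ) + 1)) := by
  have hj := j.isLt
  have hk := k.isLt
  have h := congrArg (Complex.ofReal) (sum_mid_cos_mul_cos (ℓ := ℓ) (a := (j : ℕ) + 1)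
    (b := (k : ℕ) + 1) hℓ (by omega) (by omega))
  have hw : trapWeight ℓ ((j : ℕ) + 1) = 1 := by rw [trapWeight, if_neg (by omega)]
  rw [hw] at h
  have hjk : ((j : ℕ) + 1 = (k : ℕ) + 1) = (j = k) := by simp [Fin.ext_iff]
  simp only [hjk] at h
  rw [Complex.ofReal_sum] at h
  refine (Finset.sum_congr rfl fun i _ => ?_).trans (h.trans ?_)
  · rw [cosTwo_eq, cosTwo_eq]
    push_cast
    ring_nf
  · split_ifs <;> push_cast <;> ring

/-- Constants and alternating signs are the cosines of frequency 0 and ℓ, so this sum and the two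
further ones with signs are boundary cases of `sum_mid_cos_mul_cos`. -/
theorem sum_mid_cosTwo_one {ℓ : ℕ} (hℓ : 2 ≤ ℓ) (j : Fin (ℓ - 1)) :
    ∑ i : Fin (ℓ - 1), cosTwo ℓ (((i : ℕ) + 1) * ((j : ℕ) + 1)) =
      - 1 - (-1) ^ ((j : ℕ) + 1) := by
  have hj := j.isLt
  have h := congrArg (Complex.ofReal) (sum_mid_cos_mul_cos (ℓ := ℓ) (a := 0)
    (b := (j : ℕ) + 1) hℓ (by omega) (by omega))
  rw [if_neg (by omega), Complex.ofReal_sum] at h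
  refine mul_left_cancel₀ (two_ne_zero (α := ℂ)) ?_
  rw [Finset.mul_sum]
  refine (Finset.sum_congr rfl fun i _ => ?_).trans (h.trans ?_)
  · rw [cosTwo_eq]
    simp
  · push_cast
    ring

theorem cos_pi_mul_mul_div_self {ℓ : ℕ} (hℓ : 2 ≤ ℓ) (i : ℕ) :
    Real.cos (Real.pi * ((ℓ : ℝ) * (i : ℕ)) / ℓ) = (-1) ^ i := by
  have hne : (ℓ : ℝ) ≠ 0 := by positivity
  have : Real.pi * ((ℓ : ℝ) * (i : ℕ)) / ℓ = i * Real.pi := by field_simp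
  rw [this, Real.cos_nat_mul_pi]

theorem sum_mid_sign_mul_cosTwo {ℓ : ℕ} (hℓ : 2 ≤ ℓ) (j : Fin (ℓ - 1)) :
    ∑ i : Fin (ℓ - 1), (-1) ^ ((i : ℕ) + 1) * cosTwo ℓ (((i : ℕ) + 1) * ((j : ℕ) + 1)) =
      - 1 - (-1) ^ ℓ * (-1) ^ ((j : ℕ) + 1) := by
  have hj := j.isLt
  have h := congrArg (Complex.ofReal) (sum_mid_cos_mul_cos (ℓ := ℓ) (a := ℓ)
    (b := (j : ℕ) + 1) hℓ (by omega) (by omega))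
  rw [if_neg (by omega), Complex.ofReal_sum] at h
  refine mul_left_cancel₀ (two_ne_zero (α := ℂ)) ?_
  rw [Finset.mul_sum]
  refine (Finset.sum_congr rfl fun i _ => ?_).trans (h.trans ?_)
  · rw [cosTwo_eq, cos_pi_mul_mul_div_self hℓ]
    push_cast
    ring
  · push_cast
    ring

theorem sum_mid_sign {ℓ : ℕ} (hℓ : 2 ≤ ℓ) :
    ∑ i : Fin (ℓ - 1), (-1 : ℂ) ^ ((i : ℕ) + 1) = (- 1 - (-1) ^ ℓ) / 2 := by
  have h := congrArg (Complex.ofReal) (sum_mid_cos_mul_cos (ℓ := ℓ) (a := ℓ)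
    (b := 0) hℓ le_rfl (by omega))
  rw [if_neg (by omega), Complex.ofReal_sum] at h
  refine mul_left_cancel₀ (show (4 : ℂ) ≠ 0 by norm_num) ?_
  rw [Finset.mul_sum]
  refine (Finset.sum_congr rfl fun i _ => ?_).trans (h.trans ?_)
  · rw [cos_pi_mul_mul_div_self hℓ]
    push_cast
    simp
    ring
  · push_cast
    ring

theorem conj_signedI_mul (ℓ : ℕ) : (starRingEnd ℂ) (signedI ℓ) * signedI ℓ = 1 := by
  rw [signedI_eq, map_pow, ← mul_pow]
  simp

theorem conj_rt (n : ℕ) : (starRingEnd ℂ) (rt n) = rt n := Complex.conj_ofReal _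

theorem conj_cosTwo (ℓ j : ℕ) : (starRingEnd ℂ) (cosTwo ℓ j) = cosTwo ℓ j := Complex.conj_ofReal _

/-- The Kac-Peterson matrix up to a scalar factor. -/
def scaledTable (ℓ : ℕ) : Matrix (Label ℓ) (Label ℓ) ℂ :=
  Matrix.of fun x y => rowScale ℓ x * table ℓ x y

theorem scaledTable_inl_inl {ℓ : ℕ} (hℓ : 2 ≤ ℓ) (b c : Fin 4) :
    ((scaledTable ℓ)ᴴ * scaledTable ℓ) (.inl b) (.inl c) = if b = c then 8 * (ℓ : ℂ) else 0 := by
  have hs := sum_mid_sign hℓ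
  have hε := conj_signedI_mul ℓ
  have hr := rt_mul_self ℓ
  have hc : ((ℓ - 1 : ℕ) : ℂ) = ℓ - 1 := by rw [Nat.cast_sub (by omega)]; simp
  have hsq : ∀ k : ℕ, ((-1 : ℂ) ^ k) * (-1) ^ k = 1 := by
    intro k; rw [← mul_pow]; simp
  have h4 : ∀ x y : Fin (ℓ - 1) → ℂ, ∑ i, 2 * x i * (2 * y i) = 4 * ∑ i, x i * y i := by
    intro x y; rw [Finset.mul_sum]; refine Finset.sum_congr rfl fun i _ => by ring
  -- On the middle rows the first four columns agree in pairs {0, 1} and {2, 3}; the quotient by 2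
  -- names the pair.
  have hm : ∑ i : Fin (ℓ - 1), 2 * (![1, 1, (-1) ^ ((i : ℕ) + 1), (-1) ^ ((i : ℕ) + 1)] :
      Fin 4 → ℂ) b * (2 * (![1, 1, (-1) ^ ((i : ℕ) + 1), (-1) ^ ((i : ℕ) + 1)] :
      Fin 4 → ℂ) c) = if (b : ℕ) / 2 = (c : ℕ) / 2 then 4 * ((ℓ : ℂ) - 1)
        else - 2 - 2 * (-1) ^ ℓ := by
    rw [h4]
    fin_cases b <;> fin_cases c <;> simp [hsq, hs, hc] <;> ring
  have hl : ((-1 : ℂ) ^ ℓ) * (-1) ^ ℓ = 1 := hsq ℓ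
  rw [Matrix.mul_apply, Fintype.sum_sum_type, Fintype.sum_sum_type]
  have e : ∑ i : Fin (ℓ - 1), (scaledTable ℓ)ᴴ (.inl b) (.inr (.inl i)) *
      scaledTable ℓ (.inr (.inl i)) (.inl c) = if (b : ℕ) / 2 = (c : ℕ) / 2 then
        4 * ((ℓ : ℂ) - 1) else - 2 - 2 * (-1) ^ ℓ := by
    rw [← hm]
    refine Finset.sum_congr rfl fun i _ => ?_
    fin_cases b <;> simp [scaledTable, rowScale, table]
  rw [e, Fin.sum_univ_four, Fin.sum_univ_four]
  generalize hS : (-1 : ℂ) ^ ℓ = S at hl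
  have hS' : (starRingEnd ℂ) S = S := by rw [← hS]; simp
  fin_cases b <;> fin_cases c <;>
    simp [scaledTable, rowScale, table, conj_rt, hS, hS'] <;> grind

theorem scaledTable_inl_mid {ℓ : ℕ} (hℓ : 2 ≤ ℓ) (b : Fin 4) (j : Fin (ℓ - 1)) :
    ((scaledTable ℓ)ᴴ * scaledTable ℓ) (.inl b) (.inr (.inl j)) = 0 := by
  have h1 := sum_mid_cosTwo_one hℓ j
  have h2 := sum_mid_sign_mul_cosTwo hℓ j
  have h4 : ∀ x y : Fin (ℓ - 1) → ℂ, ∑ i, 2 * x i * (2 * y i) = 4 * ∑ i, x i * y i := by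
    intro x y; rw [Finset.mul_sum]; refine Finset.sum_congr rfl fun i _ => by ring
  rw [Matrix.mul_apply, Fintype.sum_sum_type, Fintype.sum_sum_type]
  have e : ∑ i : Fin (ℓ - 1), (scaledTable ℓ)ᴴ (.inl b) (.inr (.inl i)) *
      scaledTable ℓ (.inr (.inl i)) (.inr (.inl j)) =
      4 * ∑ i : Fin (ℓ - 1), (![1, 1, (-1) ^ ((i : ℕ) + 1), (-1) ^ ((i : ℕ) + 1)] :
        Fin 4 → ℂ) b * cosTwo ℓ (((i : ℕ) + 1) * ((j : ℕ) + 1)) := by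
    rw [← h4]
    refine Finset.sum_congr rfl fun i _ => ?_
    fin_cases b <;> simp [scaledTable, rowScale, table]
  rw [e, Fin.sum_univ_four, Fin.sum_univ_four]
  fin_cases b <;> simp [scaledTable, rowScale, table, h1, h2] <;> ring

theorem scaledTable_inl_mu (ℓ : ℕ) (b c : Fin 4) :
    ((scaledTable ℓ)ᴴ * scaledTable ℓ) (.inl b) (.inr (.inr c)) = 0 := by
  rw [Matrix.mul_apply, Fintype.sum_sum_type, Fintype.sum_sum_type, Fin.sum_univ_four,
    Fin.sum_univ_four, Finset.sum_eq_zero fun i _ => by simp [scaledTable, table]]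
  simp only [scaledTable, rowScale, table, Matrix.of_apply, Matrix.conjTranspose_apply, blockW_eq]
  fin_cases b <;> fin_cases c <;> simp [signFirst, signLast, conj_rt] <;> ring

theorem scaledTable_mid_mid {ℓ : ℕ} (hℓ : 2 ≤ ℓ) (j k : Fin (ℓ - 1)) :
    ((scaledTable ℓ)ᴴ * scaledTable ℓ) (.inr (.inl j)) (.inr (.inl k)) =
      if j = k then 8 * (ℓ : ℂ) else 0 := by
  have h := sum_mid_cosTwo hℓ j k
  rw [Matrix.mul_apply, Fintype.sum_sum_type, Fintype.sum_sum_type]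
  have e : ∑ i : Fin (ℓ - 1), (scaledTable ℓ)ᴴ (.inr (.inl j)) (.inr (.inl i)) *
      scaledTable ℓ (.inr (.inl i)) (.inr (.inl k)) =
      4 * ∑ i : Fin (ℓ - 1), cosTwo ℓ (((i : ℕ) + 1) * ((j : ℕ) + 1)) *
        cosTwo ℓ (((i : ℕ) + 1) * ((k : ℕ) + 1)) := by
    rw [Finset.mul_sum]
    refine Finset.sum_congr rfl fun i _ => ?_
    simp [scaledTable, rowScale, table, conj_cosTwo]
    ring
  rw [e, h, Fin.sum_univ_four, Fin.sum_univ_four]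
  simp [scaledTable, rowScale, table]
  split_ifs <;> ring

theorem scaledTable_mid_mu (ℓ : ℕ) (j : Fin (ℓ - 1)) (c : Fin 4) :
    ((scaledTable ℓ)ᴴ * scaledTable ℓ) (.inr (.inl j)) (.inr (.inr c)) = 0 := by
  rw [Matrix.mul_apply, Fintype.sum_sum_type, Fintype.sum_sum_type, Fin.sum_univ_four,
    Fin.sum_univ_four, Finset.sum_eq_zero fun i _ => by simp [scaledTable, table]]
  fin_cases c <;> simp [scaledTable, rowScale, table]

theorem scaledTable_mu_mu (ℓ : ℕ) (b c : Fin 4) :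
    ((scaledTable ℓ)ᴴ * scaledTable ℓ) (.inr (.inr b)) (.inr (.inr c)) =
      if b = c then 8 * (ℓ : ℂ) else 0 := by
  have hε := conj_signedI_mul ℓ
  have hr := rt_mul_self ℓ
  have h2 : rt 2 * rt 2 = 2 := by simpa using rt_mul_self 2
  have h2' : rt 2 ≠ 0 := rt_ne_zero two_pos
  rw [Matrix.mul_apply, Fintype.sum_sum_type, Fintype.sum_sum_type, Fin.sum_univ_four,
    Fin.sum_univ_four, Finset.sum_eq_zero fun i _ => by simp [scaledTable, table]]
  simp only [scaledTable, rowScale, table, Matrix.of_apply, Matrix.conjTranspose_apply, blockW_eq]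
  fin_cases b <;> fin_cases c <;> simp [signFirst, signLast, conj_rt] <;> field_simp <;> grind

theorem scaledTable_unitary {ℓ : ℕ} (hℓ : 2 ≤ ℓ) :
    (scaledTable ℓ)ᴴ * scaledTable ℓ = (8 * (ℓ : ℂ)) • 1 := by
  have hsymm : ∀ x y, ((scaledTable ℓ)ᴴ * scaledTable ℓ) x y =
      star (((scaledTable ℓ)ᴴ * scaledTable ℓ) y x) := by
    intro x y
    rw [← Matrix.conjTranspose_apply, Matrix.conjTranspose_mul, Matrix.conjTranspose_conjTranspose]
  ext x y
  rw [Matrix.smul_apply, Matrix.one_apply, smul_eq_mul, mul_ite, mul_one, mul_zero]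
  rcases x with a | i | a <;> rcases y with b | j | b
  · rw [scaledTable_inl_inl hℓ]; simp
  · rw [scaledTable_inl_mid hℓ]; simp
  · rw [scaledTable_inl_mu]; simp
  · rw [hsymm, scaledTable_inl_mid hℓ]; simp
  · rw [scaledTable_mid_mid hℓ]; simp
  · rw [scaledTable_mid_mu]; simp
  · rw [hsymm, scaledTable_inl_mu]; simp
  · rw [hsymm, scaledTable_mid_mu]; simp
  · rw [scaledTable_mu_mu]; simp

end Unitarity

/-! ### Characters of the fusion algebra of a unitary matrix. -/

section CharacterTable

/-- Verlinde's formula says that S diagonalises the fusion product. Written in the basis of the rows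
of S, a multiplicative χ has coordinates whose products in pairs vanish, so χ is a multiple of a
single row, and the value 1 at o normalises it. -/
theorem isCharacterTable_sMatrix {ι : Type*} [Fintype ι] [DecidableEq ι] {S : Matrix ι ι ℂ}
    {o : ι} (hS : Sᴴ * S = 1) (ho : ∀ k, S k o ≠ 0) : IsCharacterTable S o (sMatrix S o) := by
  have hcol : ∀ a b, ∑ k, star (S k a) * S k b = if a = b then 1 else 0 := fun a b => by
    have := congrFun (congrFun hS a) b
    rwa [Matrix.mul_apply, Matrix.one_apply] at this
  have hrow : ∀ j k, ∑ a, S j a * star (S k a) = if j = k then 1 else 0 := fun j k => by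
    have hS' : S * Sᴴ = 1 := mul_eq_one_comm.mp hS
    have := congrFun (congrFun hS' j) k
    rwa [Matrix.mul_apply, Matrix.one_apply] at this
  have hfus : ∀ (χ : ι → ℂ) a b, ∑ m, fusionCoeff S o a b m * χ m =
      ∑ k, S k a * S k b / S k o * ∑ m, star (S k m) * χ m := by
    intro χ a b
    simp only [fusionCoeff, Finset.sum_mul, Finset.mul_sum]
    rw [Finset.sum_comm]
    refine Finset.sum_congr rfl fun k _ => Finset.sum_congr rfl fun m _ => ?_
    ring
  refine ⟨fun i j hij => ?_, Set.Subset.antisymm ?_ ?_⟩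
  · by_contra hne
    have h : ∀ a, S i a / S i o = S j a / S j o := fun a => congrFun hij a
    have h1 : ∑ a, S i a / S i o * star (S i a) = (S i o)⁻¹ := by
      have : ∀ a, S i a / S i o * star (S i a) = (S i o)⁻¹ * (S i a * star (S i a)) :=
        fun a => by ring
      rw [Finset.sum_congr rfl fun a _ => this a, ← Finset.mul_sum, hrow, if_pos rfl, mul_one]
    have h2 : ∑ a, S j a / S j o * star (S i a) = 0 := by
      have : ∀ a, S j a / S j o * star (S i a) = (S j o)⁻¹ * (S j a * star (S i a)) :=
        fun a => by ring
      rw [Finset.sum_congr rfl fun a _ => this a, ← Finset.mul_sum, hrow,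
        if_neg (Ne.symm hne), mul_zero]
    rw [Finset.sum_congr rfl fun a _ => by rw [h a], h2] at h1
    exact inv_ne_zero (ho i) h1.symm
  · rintro χ ⟨j, rfl⟩
    refine ⟨div_self (ho j), fun a b => ?_⟩
    rw [hfus]
    have hy : ∀ k, ∑ m, star (S k m) * (sMatrix S o).row j m =
        (S j o)⁻¹ * if j = k then 1 else 0 := by
      intro k
      rw [← hrow j k, Finset.mul_sum]
      refine Finset.sum_congr rfl fun m _ => ?_
      simp only [sMatrix, Matrix.row, Matrix.of_apply]
      ring
    simp only [hy]
    rw [Finset.sum_eq_single j (fun k _ hk => by rw [if_neg (Ne.symm hk)]; simp) (by simp)]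
    simp only [sMatrix, Matrix.row, Matrix.of_apply, if_true]
    ring
  · rintro χ ⟨h1, hmul⟩
    set y : ι → ℂ := fun k => ∑ m, star (S k m) * χ m with hy
    have hexp : ∀ a, χ a = ∑ k, y k * S k a := by
      intro a
      simp only [hy, Finset.sum_mul]
      rw [Finset.sum_comm]
      have : ∀ m, ∑ k, star (S k m) * χ m * S k a = χ m * if m = a then 1 else 0 := by
        intro m
        rw [← hcol m a, Finset.mul_sum]
        refine Finset.sum_congr rfl fun k _ => by ring
      simp only [this]
      simp
    -- Pairing χ a * χ b with the conjugates of rows j and l in a and b leaves only terms k with k =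
    -- j and k = l.
    have hyy : ∀ j l, j ≠ l → y j * y l = 0 := by
      intro j l hjl
      have e1 : y j * y l = ∑ a, ∑ b, star (S j a) * star (S l b) * (χ a * χ b) := by
        simp only [hy, Finset.sum_mul_sum]
        refine Finset.sum_congr rfl fun a _ => Finset.sum_congr rfl fun b _ => by ring
      have e2 : ∀ a b, χ a * χ b = ∑ k, S k a * S k b / S k o * y k := fun a b => by
        rw [hmul, hfus]
      have e3 : y j * y l = ∑ k, (∑ a, S k a * star (S j a)) * (∑ b, S k b * star (S l b)) *
          (y k / S k o) := by
        rw [e1]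
        simp only [Finset.sum_mul_sum]
        simp only [e2, Finset.mul_sum, Finset.sum_mul]
        rw [Finset.sum_congr rfl fun a _ => Finset.sum_comm, Finset.sum_comm]
        refine Finset.sum_congr rfl fun k _ => Finset.sum_congr rfl fun a _ =>
          Finset.sum_congr rfl fun b _ => by ring
      rw [e3]
      refine Finset.sum_eq_zero fun k _ => ?_
      rw [hrow, hrow]
      by_cases hkj : k = j
      · rw [if_neg (show ¬ k = l from fun h => hjl (hkj.symm.trans h))]; simp
      · rw [if_neg hkj]; simp
    obtain ⟨j, hj⟩ : ∃ j, y j ≠ 0 := by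
      by_contra! h
      have := hexp o
      simp [h, h1] at this
    have hχ : ∀ a, χ a = y j * S j a := by
      intro a
      rw [hexp, Finset.sum_eq_single j _ (by simp)]
      intro k _ hk
      rw [(mul_eq_zero.mp (hyy j k (Ne.symm hk))).resolve_left hj, zero_mul]
    refine ⟨j, ?_⟩
    ext a
    have hjo : y j * S j o = 1 := by rw [← hχ, h1]
    simp only [sMatrix, Matrix.row, Matrix.of_apply]
    rw [hχ, eq_div_of_mul_eq (ho j) hjo]
    ring

end CharacterTable

/-! ### The labels exhaust the weights of level 2 without repetition. -/

section Enumeration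

theorem sum_Icc_eq_three {M : Type*} [AddCommMonoid M] {ℓ : ℕ} (hℓ : 3 ≤ ℓ) {f : ℕ → M}
    (hf : ∀ j, 2 ≤ j → j + 2 ≤ ℓ → f j = 0) :
    ∑ j ∈ Finset.Icc 1 ℓ, f j = f 1 + f (ℓ - 1) + f ℓ := by
  have h : ({1, ℓ - 1, ℓ} : Finset ℕ) ⊆ Finset.Icc 1 ℓ := by
    intro j hj
    simp only [Finset.mem_insert, Finset.mem_singleton] at hj
    rw [Finset.mem_Icc]
    omega
  rw [← Finset.sum_subset h, Finset.sum_insert, Finset.sum_insert, Finset.sum_singleton, add_assoc]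
  · simp only [Finset.mem_singleton]; omega
  · simp only [Finset.mem_insert, Finset.mem_singleton]; omega
  · intro j hj hj'
    simp only [Finset.mem_insert, Finset.mem_singleton, not_or] at hj'
    rw [Finset.mem_Icc] at hj
    exact hf j (by omega) (by omega)

theorem rhoBar_add_mem_levelWeights {ℓ : ℕ} (hℓ : 3 ≤ ℓ) (p q r : ℕ) (h : p + q + r ≤ 2) :
    rhoBar ℓ + ((p : ℝ) • fundWeight ℓ 1 + (q : ℝ) • fundWeight ℓ (ℓ - 1) +
      (r : ℝ) • fundWeight ℓ ℓ) ∈ levelWeights ℓ 2 := by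
  set l : ℕ → ℕ := fun j => if j = 1 then p else if j = ℓ - 1 then q else if j = ℓ then r else 0
    with hl
  have h0 : ∀ j, 2 ≤ j → j + 2 ≤ ℓ → l j = 0 := fun j h1 h2 => by
    simp only [hl]
    rw [if_neg (by omega), if_neg (by omega), if_neg (by omega)]
  have l1 : l 1 = p := by simp [hl]
  have l2 : l (ℓ - 1) = q := by
    simp only [hl]
    rw [if_neg (by omega), if_pos trivial]
  have l3 : l ℓ = r := by
    simp only [hl]
    rw [if_neg (by omega), if_neg (by omega), if_pos trivial]
  refine ⟨l, ?_, ?_⟩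
  · rw [sum_Icc_eq_three hℓ (fun j h1 h2 => by rw [h0 j h1 h2, mul_zero]), l1, l2, l3, comark,
      comark, comark, if_neg (by omega), if_neg (by omega), if_neg (by omega)]
    omega
  · rw [sum_Icc_eq_three hℓ (fun j h1 h2 => by rw [h0 j h1 h2, Nat.cast_zero, zero_smul]), l1, l2,
      l3]

theorem rhoBar_add_fundWeight_mem_levelWeights {ℓ j : ℕ} (hj : 1 ≤ j) (hjℓ : j ≤ ℓ) :
    rhoBar ℓ + fundWeight ℓ j ∈ levelWeights ℓ 2 := by
  have hmem : j ∈ Finset.Icc 1 ℓ := Finset.mem_Icc.mpr ⟨hj, hjℓ⟩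
  refine ⟨Pi.single j 1, ?_, ?_⟩
  · rw [Finset.sum_eq_single_of_mem j hmem (fun k _ hk => by simp [hk])]
    simp only [Pi.single_eq_same, mul_one, comark]
    split_ifs <;> omega
  · rw [Finset.sum_eq_single_of_mem j hmem (fun k _ hk => by simp [hk])]
    simp

theorem labelWeight_mem_levelWeights {ℓ : ℕ} (hℓ : 3 ≤ ℓ) (x : Label ℓ) :
    labelWeight ℓ x ∈ levelWeights ℓ 2 := by
  have h := rhoBar_add_mem_levelWeights hℓ
  rcases x with a | i | b
  · fin_cases a
    · simpa [labelWeight] using h 0 0 0 (by omega)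
    · simpa [labelWeight] using h 2 0 0 (by omega)
    · simpa [labelWeight] using h 0 2 0 (by omega)
    · simpa [labelWeight] using h 0 0 2 (by omega)
  · have hi := i.isLt
    simp only [labelWeight]
    split_ifs
    · simpa using h 0 1 1 (by omega)
    · exact rhoBar_add_fundWeight_mem_levelWeights (by omega) (by omega)
  · fin_cases b
    · simpa [labelWeight] using h 0 0 1 (by omega)
    · simpa [labelWeight] using h 0 1 0 (by omega)
    · simpa [labelWeight] using h 1 0 1 (by omega)
    · simpa [labelWeight] using h 1 1 0 (by omega)

theorem exists_labelWeight_eq {ℓ : ℕ} (hℓ : 3 ≤ ℓ) {v : Fin ℓ → ℝ} (hv : v ∈ levelWeights ℓ 2) :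
    ∃ x, labelWeight ℓ x = v := by
  obtain ⟨l, hl, rfl⟩ := hv
  by_cases hmid : ∃ j, 2 ≤ j ∧ j + 2 ≤ ℓ ∧ l j ≠ 0
  · obtain ⟨j, hj2, hjℓ, hj⟩ := hmid
    have hmem : j ∈ Finset.Icc 1 ℓ := Finset.mem_Icc.mpr (by omega)
    have hc : comark ℓ j = 2 := if_pos ⟨hj2, hjℓ⟩
    rw [← Finset.add_sum_erase _ _ hmem, hc] at hl
    -- A label of comark 2 uses up the whole level, so its coefficient is 1 and all others vanish.
    have hlj : l j = 1 := by omega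
    have hrest : ∀ k ∈ (Finset.Icc 1 ℓ).erase j, l k = 0 := by
      have h0 : ∑ k ∈ (Finset.Icc 1 ℓ).erase j, comark ℓ k * l k = 0 := by omega
      intro k hk
      have := (Finset.sum_eq_zero_iff.mp h0) k hk
      refine (Nat.mul_eq_zero.mp this).resolve_left ?_
      unfold comark
      split_ifs <;> norm_num
    refine ⟨.inr (.inl ⟨j - 1, by omega⟩), ?_⟩
    rw [← Finset.add_sum_erase _ _ hmem, Finset.sum_eq_zero fun k hk => by
      rw [hrest k hk, Nat.cast_zero, zero_smul], hlj]
    simp only [labelWeight]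
    rw [if_neg (by omega), show j - 1 + 1 = j by omega]
    simp
  · push Not at hmid
    rw [sum_Icc_eq_three hℓ (fun j h1 h2 => by rw [hmid j h1 h2, mul_zero]), comark, comark, comark,
      if_neg (by omega), if_neg (by omega), if_neg (by omega)] at hl
    rw [sum_Icc_eq_three hℓ (fun j h1 h2 => by rw [hmid j h1 h2, Nat.cast_zero, zero_smul])]
    generalize l 1 = p at hl ⊢
    generalize l (ℓ - 1) = q at hl ⊢
    generalize l ℓ = r at hl ⊢
    -- Only the nodes 1, ℓ - 1, ℓ of comark 1 remain, and p + q + r ≤ 2 has ten solutions.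
    have hcases : (p = 0 ∧ q = 0 ∧ r = 0) ∨ (p = 2 ∧ q = 0 ∧ r = 0) ∨ (p = 0 ∧ q = 2 ∧ r = 0) ∨
        (p = 0 ∧ q = 0 ∧ r = 2) ∨ (p = 1 ∧ q = 0 ∧ r = 0) ∨ (p = 0 ∧ q = 1 ∧ r = 1) ∨
        (p = 0 ∧ q = 0 ∧ r = 1) ∨ (p = 0 ∧ q = 1 ∧ r = 0) ∨ (p = 1 ∧ q = 0 ∧ r = 1) ∨
        (p = 1 ∧ q = 1 ∧ r = 0) := by omega
    rcases hcases with ⟨rfl, rfl, rfl⟩ | ⟨rfl, rfl, rfl⟩ | ⟨rfl, rfl, rfl⟩ | ⟨rfl, rfl, rfl⟩ |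
      ⟨rfl, rfl, rfl⟩ | ⟨rfl, rfl, rfl⟩ | ⟨rfl, rfl, rfl⟩ | ⟨rfl, rfl, rfl⟩ | ⟨rfl, rfl, rfl⟩ |
      ⟨rfl, rfl, rfl⟩
    · exact ⟨.inl 0, by simp [labelWeight]⟩
    · exact ⟨.inl 1, by simp [labelWeight]⟩
    · exact ⟨.inl 2, by simp [labelWeight]⟩
    · exact ⟨.inl 3, by simp [labelWeight]⟩
    · refine ⟨.inr (.inl ⟨0, by omega⟩), ?_⟩
      simp only [labelWeight]
      rw [if_neg (by omega)]
      simp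
    · refine ⟨.inr (.inl ⟨ℓ - 2, by omega⟩), ?_⟩
      simp only [labelWeight]
      rw [if_pos (by omega)]
      simp
    · exact ⟨.inr (.inr 0), by simp [labelWeight]⟩
    · exact ⟨.inr (.inr 1), by simp [labelWeight]⟩
    · exact ⟨.inr (.inr 2), by simp [labelWeight]⟩
    · exact ⟨.inr (.inr 3), by simp [labelWeight]⟩

/-- Equal weights have equal Weyl sums, hence equal rows of the invertible matrix `scaledTable`; no
comparison of coordinates is needed. -/
theorem labelWeight_injective {ℓ : ℕ} (hℓ : 3 ≤ ℓ) : Function.Injective (labelWeight ℓ) := by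
  intro x y hxy
  obtain ⟨m, hm, h⟩ := exists_weylSum_labelWeight hℓ
  have hm' : (m : ℂ) ≠ 0 := by exact_mod_cast hm
  have hℓ' : (8 * (ℓ : ℂ)) ≠ 0 := by
    have : (ℓ : ℂ) ≠ 0 := by exact_mod_cast (show ℓ ≠ 0 by omega)
    simpa using this
  have hT : ∀ z, scaledTable ℓ x z = scaledTable ℓ y z := by
    intro z
    have := (h x z).symm.trans ((congrArg (weylSum ℓ 2 · _) hxy).trans (h y z))
    exact mul_left_cancel₀ hm' this
  have hU : scaledTable ℓ * ((8 * (ℓ : ℂ))⁻¹ • (scaledTable ℓ)ᴴ) = 1 := by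
    rw [mul_eq_one_comm, Matrix.smul_mul, scaledTable_unitary (by omega), smul_smul,
      inv_mul_cancel₀ hℓ', one_smul]
  have h1 := congrFun (congrFun hU x) y
  have h2 := congrFun (congrFun hU y) y
  rw [Matrix.mul_apply] at h1 h2
  simp only [hT] at h1
  rw [h2, Matrix.one_apply_eq, Matrix.one_apply] at h1
  by_contra hne
  rw [if_neg hne] at h1
  exact one_ne_zero h1

/-- The bijection between the labels and the weights of level `2`. -/
def labelEquiv {ℓ : ℕ} (hℓ : 3 ≤ ℓ) : Label ℓ ≃ levelWeights ℓ 2 :=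
  Equiv.ofBijective (fun x => ⟨labelWeight ℓ x, labelWeight_mem_levelWeights hℓ x⟩)
    ⟨fun _ _ h => labelWeight_injective hℓ (congrArg Subtype.val h), fun v => by
      obtain ⟨x, hx⟩ := exists_labelWeight_eq hℓ v.2
      exact ⟨x, Subtype.ext hx⟩⟩

theorem coe_labelEquiv {ℓ : ℕ} (hℓ : 3 ≤ ℓ) (x : Label ℓ) :
    (labelEquiv hℓ x : Fin ℓ → ℝ) = labelWeight ℓ x := rfl

theorem labelEquiv_vacuum {ℓ : ℕ} (hℓ : 3 ≤ ℓ) : labelEquiv hℓ (.inl 0) = vacuum ℓ 2 := by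
  refine Subtype.ext ?_
  rw [coe_labelEquiv]
  simp [labelWeight, vacuum]

end Enumeration

/-! ### Existence, uniqueness and normalisation of the Kac–Peterson matrix. -/

section KacPeterson

theorem table_inl_zero_right (ℓ : ℕ) (x : Label ℓ) : table ℓ x (.inl 0) = 1 := by
  rcases x with a | i | a
  · fin_cases a <;> simp [table]
  · simp [table]
  · fin_cases a <;> simp [table]

theorem rowScale_pos {ℓ : ℕ} (hℓ : 0 < ℓ) (x : Label ℓ) : ∃ r : ℝ, 0 < r ∧ rowScale ℓ x = r := by
  rcases x with a | i | a
  · exact ⟨1, one_pos, by simp [rowScale]⟩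
  · exact ⟨2, two_pos, by simp [rowScale]⟩
  · exact ⟨Real.sqrt ℓ, Real.sqrt_pos.mpr (by positivity), rfl⟩

theorem scaledTable_inl_zero_right (ℓ : ℕ) (x : Label ℓ) :
    scaledTable ℓ x (.inl 0) = rowScale ℓ x := by
  rw [scaledTable, Matrix.of_apply, table_inl_zero_right, mul_one]

theorem scaledTable_inl_zero_left (ℓ : ℕ) (x : Label ℓ) :
    scaledTable ℓ (.inl 0) x = rowScale ℓ x := by
  rcases x with a | i | a
  · fin_cases a <;> simp [scaledTable, rowScale, table]
  · simp [scaledTable, rowScale, table]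
  · fin_cases a <;> simp [scaledTable, rowScale, table]

/-- Positivity of the vacuum entry makes the overall factor a positive real r, and unitarity forces
r² · 8ℓ = 1. Conversely, this factor works because the vacuum row and column are the positive
numbers `rowScale`. -/
theorem isKacPeterson_iff {ℓ : ℕ} (hℓ : 3 ≤ ℓ)
    (S : Matrix (levelWeights ℓ 2) (levelWeights ℓ 2) ℂ) : IsKacPeterson ℓ 2 S ↔
      S.submatrix (labelEquiv hℓ) (labelEquiv hℓ) =
        (((Real.sqrt (8 * ℓ))⁻¹ : ℝ) : ℂ) • scaledTable ℓ := by
  obtain ⟨m, hm, h⟩ := exists_weylSum_labelWeight hℓ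
  have hm' : (m : ℂ) ≠ 0 := by exact_mod_cast hm
  have hℓ0 : (0 : ℝ) < 8 * ℓ := by positivity
  have hT : (scaledTable ℓ)ᴴ * scaledTable ℓ = ((8 * ℓ : ℝ) : ℂ) • 1 := by
    rw [scaledTable_unitary (by omega)]
    push_cast
    rfl
  have h' : ∀ x y, weylSum ℓ 2 (labelEquiv hℓ x) (labelEquiv hℓ y) = m * scaledTable ℓ x y := h
  constructor
  · rintro ⟨⟨c, hc⟩, hU, hpos, -⟩
    have hsub : S.submatrix (labelEquiv hℓ) (labelEquiv hℓ) = (c * m) • scaledTable ℓ := by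
      ext x y
      rw [Matrix.submatrix_apply, hc, h', Matrix.smul_apply, smul_eq_mul, mul_assoc]
    obtain ⟨r, hr, hvac⟩ := hpos (vacuum ℓ 2)
    have hcm : c * m = r := by
      have := congrFun (congrFun hsub (.inl 0)) (.inl 0)
      rw [Matrix.submatrix_apply, labelEquiv_vacuum, hvac, Matrix.smul_apply,
        scaledTable_inl_zero_right] at this
      simpa [rowScale] using this.symm
    rw [hcm] at hsub
    have hU' : (S.submatrix (labelEquiv hℓ) (labelEquiv hℓ))ᴴ *
        S.submatrix (labelEquiv hℓ) (labelEquiv hℓ) = 1 := by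
      rw [Matrix.conjTranspose_submatrix, Matrix.submatrix_mul_equiv, hU, Matrix.submatrix_one_equiv]
    rw [hsub, Matrix.conjTranspose_smul, Matrix.smul_mul, Matrix.mul_smul, hT, smul_smul,
      smul_smul] at hU'
    have h1 := congrFun (congrFun hU' (.inl 0)) (.inl 0)
    rw [Matrix.smul_apply, Matrix.one_apply_eq, smul_eq_mul, mul_one, Complex.star_def,
      Complex.conj_ofReal, ← Complex.ofReal_mul, ← Complex.ofReal_mul, Complex.ofReal_eq_one] at h1
    have hr' : r = (Real.sqrt (8 * ℓ))⁻¹ := by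
      rw [← Real.sqrt_inv, eq_comm, Real.sqrt_eq_iff_mul_self_eq_of_pos hr]
      refine eq_inv_of_mul_eq_one_left ?_
      linarith
    rw [hsub, hr']
  · intro hS
    have hS' : ∀ x y, S (labelEquiv hℓ x) (labelEquiv hℓ y) =
        (((Real.sqrt (8 * ℓ))⁻¹ : ℝ) : ℂ) * scaledTable ℓ x y :=
      fun x y => congrFun (congrFun hS x) y
    have hk : 0 < (Real.sqrt (8 * ℓ))⁻¹ := inv_pos.mpr (Real.sqrt_pos.mpr hℓ0)
    refine ⟨⟨(((Real.sqrt (8 * ℓ))⁻¹ : ℝ) : ℂ) / m, fun a b => ?_⟩, ?_, fun a => ?_, fun a => ?_⟩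
    · obtain ⟨x, rfl⟩ := (labelEquiv hℓ).surjective a
      obtain ⟨y, rfl⟩ := (labelEquiv hℓ).surjective b
      rw [hS', h']
      field_simp
    · have hU' : (S.submatrix (labelEquiv hℓ) (labelEquiv hℓ))ᴴ *
          S.submatrix (labelEquiv hℓ) (labelEquiv hℓ) = 1 := by
        rw [hS, Matrix.conjTranspose_smul, Matrix.smul_mul, Matrix.mul_smul, hT, smul_smul,
          smul_smul, Complex.star_def, Complex.conj_ofReal, ← Complex.ofReal_mul,
          ← Complex.ofReal_mul]
        have : (Real.sqrt (8 * ℓ))⁻¹ * (Real.sqrt (8 * ℓ))⁻¹ * (8 * (ℓ : ℝ)) = 1 := by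
          rw [← mul_inv, Real.mul_self_sqrt hℓ0.le, inv_mul_cancel₀ hℓ0.ne']
        rw [this, Complex.ofReal_one, one_smul]
      rw [Matrix.conjTranspose_submatrix, Matrix.submatrix_mul_equiv] at hU'
      ext a b
      obtain ⟨x, rfl⟩ := (labelEquiv hℓ).surjective a
      obtain ⟨y, rfl⟩ := (labelEquiv hℓ).surjective b
      refine (congrFun (congrFun hU' x) y).trans ?_
      simp [Matrix.one_apply]
    · obtain ⟨x, rfl⟩ := (labelEquiv hℓ).surjective a
      obtain ⟨r, hr, hx⟩ := rowScale_pos (show 0 < ℓ by omega) x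
      refine ⟨(Real.sqrt (8 * ℓ))⁻¹ * r, mul_pos hk hr, ?_⟩
      rw [← labelEquiv_vacuum hℓ, hS', scaledTable_inl_zero_right, hx, Complex.ofReal_mul]
    · obtain ⟨x, rfl⟩ := (labelEquiv hℓ).surjective a
      obtain ⟨r, hr, hx⟩ := rowScale_pos (show 0 < ℓ by omega) x
      refine ⟨(Real.sqrt (8 * ℓ))⁻¹ * r, mul_pos hk hr, ?_⟩
      rw [← labelEquiv_vacuum hℓ, hS', scaledTable_inl_zero_left, hx, Complex.ofReal_mul]

/-- The vacuum column of the table is constantly 1, so division by the vacuum entry of a row removes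
exactly the global constant and `rowScale`. -/
theorem sMatrix_submatrix_eq_table {ℓ : ℕ} (hℓ : 3 ≤ ℓ)
    {S : Matrix (levelWeights ℓ 2) (levelWeights ℓ 2) ℂ} (hS : IsKacPeterson ℓ 2 S) :
    (sMatrix S (vacuum ℓ 2)).submatrix (labelEquiv hℓ) (labelEquiv hℓ) = table ℓ := by
  have hk : (((Real.sqrt (8 * ℓ))⁻¹ : ℝ) : ℂ) ≠ 0 := by
    have : 0 < (Real.sqrt (8 * ℓ))⁻¹ := inv_pos.mpr (Real.sqrt_pos.mpr (by positivity))
    exact_mod_cast this.ne'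
  have hS' : ∀ x y, S (labelEquiv hℓ x) (labelEquiv hℓ y) =
      (((Real.sqrt (8 * ℓ))⁻¹ : ℝ) : ℂ) * scaledTable ℓ x y :=
    fun x y => congrFun (congrFun ((isKacPeterson_iff hℓ S).mp hS) x) y
  ext x y
  obtain ⟨r, hr, hx⟩ := rowScale_pos (show 0 < ℓ by omega) x
  have hx' : rowScale ℓ x ≠ 0 := by rw [hx]; exact_mod_cast hr.ne'
  rw [Matrix.submatrix_apply, sMatrix, Matrix.of_apply, ← labelEquiv_vacuum hℓ, hS', hS',
    scaledTable_inl_zero_right, mul_div_mul_left _ _ hk, scaledTable, Matrix.of_apply,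
    mul_div_cancel_left₀ _ hx']

end KacPeterson

end KacPetersonD

end

theorem mainTheorem2 (ℓ : ℕ) (hℓ : 3 ≤ ℓ) :
    ∃ e : KacPetersonD.Label ℓ ≃ KacPetersonD.levelWeights ℓ 2,
      (∀ x, (e x : Fin ℓ → ℝ) = KacPetersonD.labelWeight ℓ x) ∧
      (∃! S, KacPetersonD.IsKacPeterson ℓ 2 S) ∧
      ∀ S, KacPetersonD.IsKacPeterson ℓ 2 S →
        (KacPetersonD.sMatrix S (KacPetersonD.vacuum ℓ 2)).submatrix e e = KacPetersonD.table ℓ ∧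
        KacPetersonD.IsCharacterTable S (KacPetersonD.vacuum ℓ 2)
          (KacPetersonD.sMatrix S (KacPetersonD.vacuum ℓ 2)) := by
  refine ⟨KacPetersonD.labelEquiv hℓ, KacPetersonD.coe_labelEquiv hℓ, ?_, fun S hS =>
    ⟨KacPetersonD.sMatrix_submatrix_eq_table hℓ hS,
      KacPetersonD.isCharacterTable_sMatrix hS.2.1 fun k => ?_⟩⟩
  · refine ⟨((((Real.sqrt (8 * ℓ))⁻¹ : ℝ) : ℂ) • KacPetersonD.scaledTable ℓ).submatrix
      (KacPetersonD.labelEquiv hℓ).symm (KacPetersonD.labelEquiv hℓ).symm, ?_, fun S hS => ?_⟩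
    · refine (KacPetersonD.isKacPeterson_iff hℓ _).mpr ?_
      ext x y
      simp
    · rw [← (KacPetersonD.isKacPeterson_iff hℓ S).mp hS]
      ext x y
      simp
  · obtain ⟨r, hr, hk⟩ := hS.2.2.1 k
    rw [hk]
    exact_mod_cast hr.ne'
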